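/- Let $K$ be a field with $\mathrm{char}(K)=0$ or $\mathrm{char}(K)>3$. Let $S_4$ act by $K$-algebra automorphisms on the polynomial ring $R=K[x_{\{i,j\}} : 1\le i<j\le 4]$ in six variables by $\sigma\cdot x_{\{i,j\}}=x_{\{\sigma(i),\sigma(j)\}}$, and let $R^{S_4}$ be the subalgebra of invariants. Put $$x_1=x_{\{1,2\}}+x_{\{3,4\}},\quad x_2=x_{\{1,3\}}+x_{\{2,4\}},\quad x_3=x_{\{1,4\}}+x_{\{2,3\}},$$ $$z_1=x_{\{1,2\}}-x_{\{3,4\}},\quad z_2=x_{\{1,3\}}-x_{\{2,4\}},\quad z_3=x_{\{1,4\}}-x_{\{2,3\}},$$ and for $w\in K[x,z]$ put $[w]=w(x_1,z_1)+w(x_2,z_2)+w(x_3,z_3)\in R$. (i) The $K$-algebra $R^{S_4}$ is generated by the ten elements $$[x],\ [x^2],\ [x^3],\ [z^2],\ [z^4],\ [z^6],\ [xz^2],\ [x^2z^2],\ [xz^4],\ z_1z_2z_3 .$$ (ii) Let $\mathcal F=K[T_w,S \mid w\in\{x,x^2,x^3,y,y^2,y^3,xy,x^2y,xy^2\}]$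 be the polynomial algebra in ten variables, let $\psi:K[x,y]\to K[x,z]$ be the $K$-algebra homomorphism with $x\mapsto x$, $y\mapsto z^2$, and let $\phi:\mathcal F\to R$ be the $K$-algebra homomorphism with $\phi(S)=z_1z_2z_3$ and $\phi(T_w)=[\psi(w)]$. Then the image of $\phi$ is $R^{S_4}$, and the ideal $\ker(\phi)$ is minimally generated by the six elements $$S^2-\tfrac13T_{y^3}+\tfrac12T_{y^2}T_y-\tfrac16T_y^3,\quad J_{3,2},\ J_{2,3},\ J_{4,2},\ J_{3,3},\ J_{2,4};$$ that is, they generate $\ker(\phi)$ as an ideal and none of the six lies in the ideal generated by the other five. Here $$\begin{aligned}J_{3,2}={}&6T_{x^2y}T_{xy}-3T_{xy^2}T_{x^2}-2T_{x^2y}T_{x}T_{y}+T_{xy^2}T_{x}^2-4T_{xy}^2T_{x}+2T_{xy}T_{x}^2T_{y}\\&-3T_{x^3}T_{y^2}+4T_{x^2}T_{x}T_{y^2}-T_{x}^3T_{y^2}+T_{x^3}T_{y}^2-T_{x^2}T_{x}T_{y}^2,\end{aligned}$$ $$\begin{aligned}J_{2,3}={}&6T_{xy^2}T_{xy}-3T_{x^2y}T_{y^2}-2T_{xy^2}T_{x}T_{y}+T_{x^2y}T_{y}^2-4T_{xy}^2T_{y}+2T_{xy}T_{y}^2T_{x}\\&-3T_{y^3}T_{x^2}+4T_{y^2}T_{y}T_{x^2}-T_{y}^3T_{x^2}+T_{y^3}T_{x}^2-T_{y^2}T_{y}T_{x}^2,\end{aligned}$$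 $$\begin{aligned}J_{4,2}={}&6T_{x^2y}^2+T_{xy}^2T_{x^2}-3T_{xy}^2T_{x}^2-6T_{x^3}T_{xy^2}+2T_{x^2}T_{xy^2}T_{x}+4T_{x^3}T_{xy}T_{y}\\&-2T_{x^2}T_{xy}T_{x}T_{y}+2T_{xy}T_{x}^3T_{y}-4T_{x^2y}T_{x^2}T_{y}-T_{x^2}^2T_{y^2}+T_{x^2}^2T_{y}^2\\&+4T_{x^2}T_{x}^2T_{y^2}-T_{x^2}T_{x}^2T_{y}^2-T_{x}^4T_{y^2}-2T_{x^3}T_{x}T_{y^2},\end{aligned}$$ $$\begin{aligned}J_{3,3}={}&3T_{x^2y}T_{xy^2}-T_{xy}T_{x^2}T_{y^2}+T_{xy}^3+T_{xy}T_x^2T_{y^2}-5T_{xy}^2T_xT_y-3T_{x^3}T_{y^3}\\&+2T_{xy}T_{xy^2}T_x+T_{x^2}T_xT_{y^3}-3T_{x^2}T_{xy^2}T_y+2T_{x^2y}T_{xy}T_y+3T_{x^2}T_xT_{y^2}T_y\\&+T_{x^3}T_{y^2}T_y+T_{x^2}T_{xy}T_y^2-T_x^3T_{y^2}T_y+2T_x^2T_{xy}T_y^2-T_{x^2}T_xT_y^3-3T_xT_{x^2y}T_{y^2},\end{aligned}$$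 $$\begin{aligned}J_{2,4}={}&6T_{xy^2}^2+T_{xy}^2T_{y^2}-3T_{xy}^2T_{y}^2-6T_{y^3}T_{x^2y}+2T_{y^2}T_{x^2y}T_{y}+4T_{y^3}T_{xy}T_{x}\\&-2T_{y^2}T_{xy}T_{x}T_{y}+2T_{xy}T_{y}^3T_{x}-4T_{xy^2}T_{y^2}T_{x}-T_{y^2}^2T_{x^2}+T_{y^2}^2T_{x}^2\\&+4T_{y^2}T_{y}^2T_{x^2}-T_{y^2}T_{y}^2T_{x}^2-T_{y}^4T_{x^2}-2T_{y^3}T_{y}T_{x^2}.\end{aligned}$$ -/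

import Mathlib

open MvPolynomial

namespace PairInv

noncomputable section

/-- The two-element subsets of `{1, …, n}`, with `{1, …, n}` modelled by `Fin n`. -/
abbrev Pair (n : ℕ) : Type := {s : Finset (Fin n) // s.card = 2}

/-- The polynomial algebra over `K` in the variables `x_{i,j}`. -/
abbrev PolyRing (n : ℕ) (K : Type*) [Field K] : Type _ := MvPolynomial (Pair n) K

/-- The permutation `σ` sends the pair `{i, j}` to `{σ i, σ j}`. -/
def permPair {n : ℕ} (σ : Equiv.Perm (Fin n)) (p : Pair n) : Pair n :=
  ⟨p.1.map σ.toEmbedding, by rw [Finset.card_map]; exact p.2⟩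

/-- The action of `σ` on the polynomial algebra: `σ · x_{i,j} = x_{σ i, σ j}`. -/
def act {n : ℕ} (K : Type*) [Field K] (σ : Equiv.Perm (Fin n)) :
    PolyRing n K →ₐ[K] PolyRing n K :=
  rename (permPair σ)

/-- The subalgebra of polynomials fixed by all permutations. -/
def invariants (n : ℕ) (K : Type*) [Field K] : Subalgebra K (PolyRing n K) where
  carrier := {f | ∀ σ : Equiv.Perm (Fin n), act K σ f = f}
  mul_mem' := fun ha hb σ => by rw [map_mul, ha σ, hb σ]
  add_mem' := fun ha hb σ => by rw [map_add, ha σ, hb σ]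
  algebraMap_mem' := fun r σ => (act K σ).commutes r

/-- The variable `x_{i,j}` for `n = 4`; here `i, j` run over `0, 1, 2, 3`. -/
def pv (K : Type*) [Field K] (i j : Fin 4) (h : ({i, j} : Finset (Fin 4)).card = 2) :
    PolyRing 4 K :=
  X ⟨{i, j}, h⟩

/-- The elements `x₁, x₂, x₃`. -/
def xx (K : Type*) [Field K] : Fin 3 → PolyRing 4 K :=
  ![pv K 0 1 (by decide) + pv K 2 3 (by decide),
    pv K 0 2 (by decide) + pv K 1 3 (by decide),
    pv K 0 3 (by decide) + pv K 1 2 (by decide)]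

/-- The elements `z₁, z₂, z₃`. -/
def zz (K : Type*) [Field K] : Fin 3 → PolyRing 4 K :=
  ![pv K 0 1 (by decide) - pv K 2 3 (by decide),
    pv K 0 2 (by decide) - pv K 1 3 (by decide),
    pv K 0 3 (by decide) - pv K 1 2 (by decide)]

/-- For `w ∈ K[x, z]` (with `x = X 0` and `z = X 1`), the element
`[w] = w ⊗ 1 ⊗ 1 + 1 ⊗ w ⊗ 1 + 1 ⊗ 1 ⊗ w` of the threefold tensor power of `K[x, z]`, where
the `i`-th tensor factor is embedded in the ring in six variables by `x ↦ xᵢ`, `z ↦ zᵢ`. -/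
def br {K : Type*} [Field K] (w : MvPolynomial (Fin 2) K) : PolyRing 4 K :=
  ∑ i : Fin 3, aeval ![xx K i, zz K i] w

/-- The product `z₁ z₂ z₃`. -/
def zprod (K : Type*) [Field K] : PolyRing 4 K := zz K 0 * zz K 1 * zz K 2

/-- The homomorphism `ψ : K[x, y] → K[x, z]`, `x ↦ x`, `y ↦ z²`. -/
def psi (K : Type*) [Field K] : MvPolynomial (Fin 2) K →ₐ[K] MvPolynomial (Fin 2) K :=
  aeval ![X 0, X 1 ^ 2]

/-- Names for the nine monomials `x, x², x³, y, y², y³, xy, x²y, xy²`. -/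
inductive Word : Type
  | x | x2 | x3 | y | y2 | y3 | xy | x2y | xy2

/-- The monomial in `K[x, y]` (with `x = X 0` and `y = X 1`) with the given name. -/
def Word.toPoly (K : Type*) [Field K] : Word → MvPolynomial (Fin 2) K
  | .x => X 0
  | .x2 => X 0 ^ 2
  | .x3 => X 0 ^ 3
  | .y => X 1
  | .y2 => X 1 ^ 2
  | .y3 => X 1 ^ 3
  | .xy => X 0 * X 1
  | .x2y => X 0 ^ 2 * X 1
  | .xy2 => X 0 * X 1 ^ 2

/-- The ten variables `T_w` and `S`. -/
inductive Var : Type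
  | T (w : Word)
  | S

/-- The ten-variable polynomial algebra `K[T_w, S]`. -/
abbrev FreeAlg (K : Type*) [Field K] : Type _ := MvPolynomial Var K

/-- The homomorphism `φ` with `φ(S) = z₁ z₂ z₃` and `φ(T_w) = [ψ(w)]`. -/
def phi (K : Type*) [Field K] : FreeAlg K →ₐ[K] PolyRing 4 K :=
  aeval fun v : Var => match v with
    | .T w => br (psi K (w.toPoly K))
    | .S => zprod K

/-- The variable `S`. -/
def S (K : Type*) [Field K] : FreeAlg K := X Var.S

/-- The variables `T_w`. -/
def T (K : Type*) [Field K] (w : Word) : FreeAlg K := X (Var.T w)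

/-- `S² - (1/3) T_{y³} + (1/2) T_{y²} T_y - (1/6) T_y³`. -/
def newtonRel (K : Type*) [Field K] : FreeAlg K :=
  S K ^ 2 - C (1 / 3 : K) * T K .y3 + C (1 / 2 : K) * T K .y2 * T K .y
    - C (1 / 6 : K) * T K .y ^ 3

/-- The element `J_{3,2}`. -/
def J32 (K : Type*) [Field K] : FreeAlg K :=
  6 * T K .x2y * T K .xy - 3 * T K .xy2 * T K .x2 - 2 * T K .x2y * T K .x * T K .y
    + T K .xy2 * T K .x ^ 2 - 4 * T K .xy ^ 2 * T K .x
    + 2 * T K .xy * T K .x ^ 2 * T K .y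
    - 3 * T K .x3 * T K .y2 + 4 * T K .x2 * T K .x * T K .y2 - T K .x ^ 3 * T K .y2
    + T K .x3 * T K .y ^ 2 - T K .x2 * T K .x * T K .y ^ 2

/-- The element `J_{2,3}`. -/
def J23 (K : Type*) [Field K] : FreeAlg K :=
  6 * T K .xy2 * T K .xy - 3 * T K .x2y * T K .y2 - 2 * T K .xy2 * T K .x * T K .y
    + T K .x2y * T K .y ^ 2 - 4 * T K .xy ^ 2 * T K .y
    + 2 * T K .xy * T K .y ^ 2 * T K .x
    - 3 * T K .y3 * T K .x2 + 4 * T K .y2 * T K .y * T K .x2 - T K .y ^ 3 * T K .x2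
    + T K .y3 * T K .x ^ 2 - T K .y2 * T K .y * T K .x ^ 2

/-- The element `J_{4,2}`. -/
def J42 (K : Type*) [Field K] : FreeAlg K :=
  6 * T K .x2y ^ 2 + T K .xy ^ 2 * T K .x2 - 3 * T K .xy ^ 2 * T K .x ^ 2
    - 6 * T K .x3 * T K .xy2 + 2 * T K .x2 * T K .xy2 * T K .x
    + 4 * T K .x3 * T K .xy * T K .y
    - 2 * T K .x2 * T K .xy * T K .x * T K .y + 2 * T K .xy * T K .x ^ 3 * T K .y
    - 4 * T K .x2y * T K .x2 * T K .y
    - T K .x2 ^ 2 * T K .y2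
    + T K .x2 ^ 2 * T K .y ^ 2 + 4 * T K .x2 * T K .x ^ 2 * T K .y2
    - T K .x2 * T K .x ^ 2 * T K .y ^ 2 - T K .x ^ 4 * T K .y2
    - 2 * T K .x3 * T K .x * T K .y2

/-- The element `J_{3,3}`. -/
def J33 (K : Type*) [Field K] : FreeAlg K :=
  3 * T K .x2y * T K .xy2 - T K .xy * T K .x2 * T K .y2 + T K .xy ^ 3
    + T K .xy * T K .x ^ 2 * T K .y2
    - 5 * T K .xy ^ 2 * T K .x * T K .y - 3 * T K .x3 * T K .y3
    + 2 * T K .xy * T K .xy2 * T K .x + T K .x2 * T K .x * T K .y3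
    - 3 * T K .x2 * T K .xy2 * T K .y + 2 * T K .x2y * T K .xy * T K .y
    + 3 * T K .x2 * T K .x * T K .y2 * T K .y
    + T K .x3 * T K .y2 * T K .y
    + T K .x2 * T K .xy * T K .y ^ 2 - T K .x ^ 3 * T K .y2 * T K .y
    + 2 * T K .x ^ 2 * T K .xy * T K .y ^ 2 - T K .x2 * T K .x * T K .y ^ 3
    - 3 * T K .x * T K .x2y * T K .y2

/-- The element `J_{2,4}`. -/
def J24 (K : Type*) [Field K] : FreeAlg K :=
  6 * T K .xy2 ^ 2 + T K .xy ^ 2 * T K .y2 - 3 * T K .xy ^ 2 * T K .y ^ 2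
    - 6 * T K .y3 * T K .x2y + 2 * T K .y2 * T K .x2y * T K .y
    + 4 * T K .y3 * T K .xy * T K .x
    - 2 * T K .y2 * T K .xy * T K .x * T K .y + 2 * T K .xy * T K .y ^ 3 * T K .x
    - 4 * T K .xy2 * T K .y2 * T K .x
    - T K .y2 ^ 2 * T K .x2
    + T K .y2 ^ 2 * T K .x ^ 2 + 4 * T K .y2 * T K .y ^ 2 * T K .x2
    - T K .y2 * T K .y ^ 2 * T K .x ^ 2 - T K .y ^ 4 * T K .x2
    - 2 * T K .y3 * T K .y * T K .x2

/-- The family of the six relations. -/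
def rels (K : Type*) [Field K] : Fin 6 → FreeAlg K :=
  ![newtonRel K, J32 K, J23 K, J42 K, J33 K, J24 K]

/-- The ideal `I` is minimally generated by the family `g`: the family generates `I`, and
no member of it lies in the ideal generated by the other members, so no proper subfamily
generates `I`. -/
def MinimallyGenerates {R ι : Type*} [CommRing R] (g : ι → R) (I : Ideal R) : Prop :=
  Ideal.span (Set.range g) = I ∧ ∀ i, g i ∉ Ideal.span (g '' {i}ᶜ)

end

end PairInv

/-!
The elements `xᵢ, zᵢ` are linear coordinates, because `2` is invertible. In them `S₄` acts through
the permutations of the three pairs `(xᵢ, zᵢ)` and the changes of an even number of signs of the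
`zᵢ`; the latter form the Klein four-group.

*Generators.* The sum of the images of a monomial in the `xᵢ, zᵢ` under the Klein four-group vanishes
unless the exponents of the `zᵢ` have the same parity. The remaining monomials are products of
monomials in the `xᵢ` and `yᵢ = zᵢ²`, and possibly of `z₁ z₂ z₃`; symmetrizing them gives polynomials
in the power sums `∑ xᵢᵃ yᵢᵇ` (`sum_perm_mul_three`). The polarised Newton identity in degree four
(`six_mul_sum_mul_four`), where `6` is invertible, reduces these power sums to those with
`a + b ≤ 3`. Since `24` is invertible, each invariant is a multiple of its own orbit sum, so this
proves `adjoin_generators`.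

*Relations.* Let `a, b, c` stand for `T_{xy}, T_{x²y}, T_{xy²}`, and let `P` be the polynomial algebra
in the other six `T_w`. The relations `J` express `ab, ac, b², c², bc` and, indirectly, `a⁴`, so the
quotient of `𝓕` by the six relations is spanned over `P` by `1, a, b, c, a², a³` and their multiples
by `S` (`mul_mem_span_basisVec`, `exists_sub_normalForm_mem`). The kernel of `φ` is no larger than the
ideal of the relations because the images of these twelve elements are linearly independent over
`P`. The automorphism `zᵢ ↦ -zᵢ` separates the multiples of `z₁ z₂ z₃` from the rest. The power sums in
`P` are algebraically independent, the polynomial ring being integral over them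
(`algebraicIndependent_purePowerSum`), and they are fixed under permutations of the `zᵢ` alone. The six
conjugates of `1, a, b, c, a², a³` under these permutations form a square matrix, whose determinant
at one point is a product of powers of `2` and `3` (`det_conjMatrix_ne_zero`).

*Minimality.* For each relation there is a point of the ten-dimensional affine space at which it does
not vanish while the five others do (`rels_not_mem`).
-/

namespace PairInv

/-! ### The action of `S₄` on the coordinates `xᵢ, zᵢ` -/

section Action

variable (K : Type*) [Field K]

theorem act_pv (σ : Equiv.Perm (Fin 4)) (i j k l : Fin 4) (h : ({i, j} : Finset (Fin 4)).card = 2)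
    (h' : ({k, l} : Finset (Fin 4)).card = 2)
    (e : ({i, j} : Finset (Fin 4)).map σ.toEmbedding = {k, l}) :
    act K σ (pv K i j h) = pv K k l h' := by
  rw [act, pv, pv, rename_X]
  exact congrArg X (Subtype.ext e)

/-- The transposition of the labels `1` and `2` interchanges the first two pairs `(xᵢ, zᵢ)`. -/
theorem act_swap_one_two (i : Fin 3) :
    act K (Equiv.swap 1 2) (xx K i) = xx K (![1, 0, 2] i) ∧
    act K (Equiv.swap 1 2) (zz K i) = zz K (![1, 0, 2] i) := by
  have h01 := act_pv K (Equiv.swap 1 2) 0 1 0 2 (by decide) (by decide) (by decide)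
  have h02 := act_pv K (Equiv.swap 1 2) 0 2 0 1 (by decide) (by decide) (by decide)
  have h03 := act_pv K (Equiv.swap 1 2) 0 3 0 3 (by decide) (by decide) (by decide)
  have h12 := act_pv K (Equiv.swap 1 2) 1 2 1 2 (by decide) (by decide) (by decide)
  have h13 := act_pv K (Equiv.swap 1 2) 1 3 2 3 (by decide) (by decide) (by decide)
  have h23 := act_pv K (Equiv.swap 1 2) 2 3 1 3 (by decide) (by decide) (by decide)
  fin_cases i <;> simp [xx, zz, h01, h02, h03, h12, h13, h23]

/-- The transposition of the labels `2` and `3` interchanges the last two pairs `(xᵢ, zᵢ)`. -/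
theorem act_swap_two_three (i : Fin 3) :
    act K (Equiv.swap 2 3) (xx K i) = xx K (![0, 2, 1] i) ∧
    act K (Equiv.swap 2 3) (zz K i) = zz K (![0, 2, 1] i) := by
  have h01 := act_pv K (Equiv.swap 2 3) 0 1 0 1 (by decide) (by decide) (by decide)
  have h02 := act_pv K (Equiv.swap 2 3) 0 2 0 3 (by decide) (by decide) (by decide)
  have h03 := act_pv K (Equiv.swap 2 3) 0 3 0 2 (by decide) (by decide) (by decide)
  have h12 := act_pv K (Equiv.swap 2 3) 1 2 1 3 (by decide) (by decide) (by decide)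
  have h13 := act_pv K (Equiv.swap 2 3) 1 3 1 2 (by decide) (by decide) (by decide)
  have h23 := act_pv K (Equiv.swap 2 3) 2 3 2 3 (by decide) (by decide) (by decide)
  fin_cases i <;> simp [xx, zz, h01, h02, h03, h12, h13, h23]

/-- The transposition of the labels `0` and `1` interchanges the last two `xᵢ`, and the last two
`zᵢ` up to sign. -/
theorem act_swap_zero_one (i : Fin 3) :
    act K (Equiv.swap 0 1) (xx K i) = xx K (![0, 2, 1] i) ∧
    act K (Equiv.swap 0 1) (zz K i) = ![1, -1, -1] i * zz K (![0, 2, 1] i) := by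
  have h01 := act_pv K (Equiv.swap 0 1) 0 1 0 1 (by decide) (by decide) (by decide)
  have h02 := act_pv K (Equiv.swap 0 1) 0 2 1 2 (by decide) (by decide) (by decide)
  have h03 := act_pv K (Equiv.swap 0 1) 0 3 1 3 (by decide) (by decide) (by decide)
  have h12 := act_pv K (Equiv.swap 0 1) 1 2 0 2 (by decide) (by decide) (by decide)
  have h13 := act_pv K (Equiv.swap 0 1) 1 3 0 3 (by decide) (by decide) (by decide)
  have h23 := act_pv K (Equiv.swap 0 1) 2 3 2 3 (by decide) (by decide) (by decide)
  fin_cases i <;> simp [xx, zz, h01, h02, h03, h12, h13, h23]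
  all_goals exact add_comm _ _

theorem act_mul (σ τ : Equiv.Perm (Fin 4)) (f : PolyRing 4 K) :
    act K (σ * τ) f = act K σ (act K τ f) := by
  rw [act, act, act, rename_rename]
  congr 2
  funext p
  exact Subtype.ext (by simp [permPair, Finset.map_map]; rfl)

theorem act_one (f : PolyRing 4 K) : act K 1 f = f := by
  have : permPair (1 : Equiv.Perm (Fin 4)) = id := by
    funext p
    exact Subtype.ext Finset.map_refl
  rw [act, this, rename_id_apply]

/-- Invariance may be tested on the three adjacent transpositions, which generate `S₄`. -/
theorem mem_invariants_of_adjacent {f : PolyRing 4 K} (h01 : act K (Equiv.swap 0 1) f = f)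
    (h12 : act K (Equiv.swap 1 2) f = f) (h23 : act K (Equiv.swap 2 3) f = f) :
    f ∈ invariants 4 K := by
  intro σ
  have hσ : σ ∈ Submonoid.closure
      (Set.range fun i : Fin 3 ↦ Equiv.swap i.castSucc i.succ) := by
    rw [Equiv.Perm.mclosure_swap_castSucc_succ]
    exact Submonoid.mem_top _
  induction hσ using Submonoid.closure_induction with
  | mem τ hτ =>
    obtain ⟨i, rfl⟩ := hτ
    fin_cases i
    exacts [h01, h12, h23]
  | one => exact act_one K f
  | mul σ τ _ _ hσ hτ => rw [act_mul, hτ, hσ]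

theorem pair_four_cases (p : Pair 4) :
    p.1 = {0, 1} ∨ p.1 = {0, 2} ∨ p.1 = {0, 3} ∨ p.1 = {1, 2} ∨ p.1 = {1, 3} ∨ p.1 = {2, 3} := by
  obtain ⟨s, hs⟩ := p
  revert s
  decide

/-- In characteristic other than two, the `xᵢ` and `zᵢ` generate the polynomial ring. -/
theorem aeval_xx_zz_surjective (h2 : (2 : K) ≠ 0) :
    Function.Surjective (aeval (Sum.elim (xx K) (zz K)) :
      MvPolynomial (Fin 3 ⊕ Fin 3) K →ₐ[K] PolyRing 4 K) := by
  rw [← AlgHom.range_eq_top, eq_top_iff, ← MvPolynomial.adjoin_range_X, Algebra.adjoin_le_iff]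
  have hC : C (2⁻¹ : K) * 2 = (1 : PolyRing 4 K) := by
    rw [show (2 : PolyRing 4 K) = C 2 from (map_ofNat C 2).symm, ← C_mul, inv_mul_cancel₀ h2, C_1]
  have hp : ∀ i : Fin 3,
      C (2⁻¹ : K) * (xx K i + zz K i) ∈ (aeval (Sum.elim (xx K) (zz K)) :
        MvPolynomial (Fin 3 ⊕ Fin 3) K →ₐ[K] PolyRing 4 K).range ∧
      C (2⁻¹ : K) * (xx K i - zz K i) ∈ (aeval (Sum.elim (xx K) (zz K)) :
        MvPolynomial (Fin 3 ⊕ Fin 3) K →ₐ[K] PolyRing 4 K).range := fun i ↦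
    ⟨⟨C 2⁻¹ * (X (.inl i) + X (.inr i)), by simp [algebraMap_eq]⟩,
      ⟨C 2⁻¹ * (X (.inl i) - X (.inr i)), by simp [algebraMap_eq]⟩⟩
  have key : ∀ (a b : PolyRing 4 K), C (2⁻¹ : K) * (a + b + (a - b)) = a ∧
      C (2⁻¹ : K) * (a + b - (a - b)) = b := fun a b ↦
    ⟨by linear_combination a * hC, by linear_combination b * hC⟩
  rintro _ ⟨p, rfl⟩
  have hX : ∀ (i j : Fin 4) (h : ({i, j} : Finset (Fin 4)).card = 2), p.1 = {i, j} →
      X p = pv K i j h := fun i j h e ↦ congrArg X (Subtype.ext e)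
  obtain h | h | h | h | h | h := pair_four_cases p
  · rw [hX 0 1 (by decide) h, ← (key (pv K 0 1 (by decide)) (pv K 2 3 (by decide))).1]
    exact (hp 0).1
  · rw [hX 0 2 (by decide) h, ← (key (pv K 0 2 (by decide)) (pv K 1 3 (by decide))).1]
    exact (hp 1).1
  · rw [hX 0 3 (by decide) h, ← (key (pv K 0 3 (by decide)) (pv K 1 2 (by decide))).1]
    exact (hp 2).1
  · rw [hX 1 2 (by decide) h, ← (key (pv K 0 3 (by decide)) (pv K 1 2 (by decide))).2]
    exact (hp 2).2
  · rw [hX 1 3 (by decide) h, ← (key (pv K 0 2 (by decide)) (pv K 1 3 (by decide))).2]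
    exact (hp 1).2
  · rw [hX 2 3 (by decide) h, ← (key (pv K 0 1 (by decide)) (pv K 2 3 (by decide))).2]
    exact (hp 0).2

end Action

/-! ### Power sums of three elements -/

section PowerSums

variable {A : Type*} [CommRing A]

/-- The polarised Newton identity: since the fourth elementary symmetric function of three
variables vanishes, the power sum of a fourfold product is a combination of products of power sums
of shorter products. -/
theorem six_mul_sum_mul_four (f g h k : Fin 3 → A) :
    6 * ∑ i, f i * g i * h i * k i =
      (∑ i, f i) * (∑ i, g i) * (∑ i, h i) * (∑ i, k i)
      - ((∑ i, f i * g i) * (∑ i, h i) * (∑ i, k i) + (∑ i, f i * h i) * (∑ i, g i) * (∑ i, k i)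
        + (∑ i, f i * k i) * (∑ i, g i) * (∑ i, h i) + (∑ i, g i * h i) * (∑ i, f i) * (∑ i, k i)
        + (∑ i, g i * k i) * (∑ i, f i) * (∑ i, h i) + (∑ i, h i * k i) * (∑ i, f i) * (∑ i, g i))
      + ((∑ i, f i * g i) * (∑ i, h i * k i) + (∑ i, f i * h i) * (∑ i, g i * k i)
        + (∑ i, f i * k i) * (∑ i, g i * h i))
      + 2 * ((∑ i, f i * g i * h i) * (∑ i, k i) + (∑ i, f i * g i * k i) * (∑ i, h i)
        + (∑ i, f i * h i * k i) * (∑ i, g i) + (∑ i, g i * h i * k i) * (∑ i, f i)) := by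
  simp only [Fin.sum_univ_three]
  ring

/-- The symmetrization of a product `f₀ g₁ h₂` is a polynomial in power sums. -/
theorem sum_perm_mul_three (f g h : Fin 3 → A) :
    f 0 * g 1 * h 2 + f 1 * g 0 * h 2 + f 0 * g 2 * h 1 + f 2 * g 0 * h 1 + f 1 * g 2 * h 0
        + f 2 * g 1 * h 0 =
      (∑ i, f i) * (∑ i, g i) * (∑ i, h i)
      - ((∑ i, f i * g i) * (∑ i, h i) + (∑ i, f i * h i) * (∑ i, g i)
        + (∑ i, g i * h i) * (∑ i, f i))
      + 2 * ∑ i, f i * g i * h i := by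
  simp only [Fin.sum_univ_three]
  ring

/-- A subalgebra over `K` containing the power sums `∑ xᵢᵃ yᵢᵇ` with `a + b ≤ 3` contains all of
them. -/
theorem sum_pow_mul_pow_mem {K : Type*} [Field K] [Algebra K A] (h2 : (2 : K) ≠ 0)
    (h3 : (3 : K) ≠ 0) (x y : Fin 3 → A) (B : Subalgebra K A)
    (hB : ∀ a b, a + b ≤ 3 → ∑ i, x i ^ a * y i ^ b ∈ B) (a b : ℕ) :
    ∑ i, x i ^ a * y i ^ b ∈ B := by
  induction hn : a + b using Nat.strong_induction_on generalizing a b with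
  | _ n ih =>
  obtain h | h := le_or_gt (a + b) 3
  · exact hB a b h
  have peel : ∀ a b : ℕ, 1 ≤ a + b → ∃ c d a' b', a = c + a' ∧ b = d + b' ∧ c + d = 1 := by
    intro a b hab
    rcases a with _ | a
    · exact ⟨0, 1, 0, b - 1, by omega⟩
    · exact ⟨1, 0, a, b, by omega⟩
  obtain ⟨c₁, d₁, a₁, b₁, ha, hb, h₁⟩ := peel a b (by omega)
  obtain ⟨c₂, d₂, a₂, b₂, ha₁, hb₁, h₂⟩ := peel a₁ b₁ (by omega)
  obtain ⟨c₃, d₃, a₃, b₃, ha₂, hb₂, h₃⟩ := peel a₂ b₂ (by omega)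
  have key := six_mul_sum_mul_four (fun i ↦ x i ^ c₁ * y i ^ d₁) (fun i ↦ x i ^ c₂ * y i ^ d₂)
    (fun i ↦ x i ^ c₃ * y i ^ d₃) (fun i ↦ x i ^ a₃ * y i ^ b₃)
  have hmul : ∀ a b c d : ℕ, ∀ i, x i ^ a * y i ^ b * (x i ^ c * y i ^ d) =
      x i ^ (a + c) * y i ^ (b + d) := fun a b c d i ↦ by ring
  simp only [hmul] at key
  have hm : ∀ a b, a + b < n → ∑ i, x i ^ a * y i ^ b ∈ B := fun a b hab ↦ ih _ hab a b rfl
  have e2 : (2 : A) ∈ B := B.natCast_mem 2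
  have h6 : (6 : K) ≠ 0 := by
    rw [show (6 : K) = 2 * 3 by norm_num]
    exact mul_ne_zero h2 h3
  have hmem : 6 * ∑ i, x i ^ a * y i ^ b ∈ B := by
    rw [show a = c₁ + c₂ + c₃ + a₃ by omega, show b = d₁ + d₂ + d₃ + b₃ by omega, key]
    refine B.add_mem (B.add_mem (B.sub_mem ?_ ?_) ?_) (B.mul_mem e2 ?_)
    · exact B.mul_mem (B.mul_mem (B.mul_mem (hm _ _ (by omega)) (hm _ _ (by omega)))
        (hm _ _ (by omega))) (hm _ _ (by omega))
    · refine B.add_mem (B.add_mem (B.add_mem (B.add_mem (B.add_mem ?_ ?_) ?_) ?_) ?_) ?_ <;>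
        exact B.mul_mem (B.mul_mem (hm _ _ (by omega)) (hm _ _ (by omega))) (hm _ _ (by omega))
    · refine B.add_mem (B.add_mem ?_ ?_) ?_ <;>
        exact B.mul_mem (hm _ _ (by omega)) (hm _ _ (by omega))
    · refine B.add_mem (B.add_mem (B.add_mem ?_ ?_) ?_) ?_ <;>
        exact B.mul_mem (hm _ _ (by omega)) (hm _ _ (by omega))
  have h6A : algebraMap K A 6⁻¹ * 6 = 1 := by
    rw [show (6 : A) = algebraMap K A 6 from (map_ofNat _ 6).symm, ← map_mul, inv_mul_cancel₀ h6,
      map_one]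
  have := B.mul_mem (B.algebraMap_mem 6⁻¹) hmem
  rwa [← mul_assoc, h6A, one_mul] at this

end PowerSums

/-! ### Generators of the algebra of invariants -/

section Generators

variable (K : Type*) [Field K]

/-- The ten generators of the algebra of invariants. -/
def generators : Set (PolyRing 4 K) :=
  {br (X 0), br (X 0 ^ 2), br (X 0 ^ 3), br (X 1 ^ 2), br (X 1 ^ 4), br (X 1 ^ 6),
    br (X 0 * X 1 ^ 2), br (X 0 ^ 2 * X 1 ^ 2), br (X 0 * X 1 ^ 4), zprod K}

theorem br_monomial (a b : ℕ) :
    br (X 0 ^ a * X 1 ^ b : MvPolynomial (Fin 2) K) = ∑ i, xx K i ^ a * zz K i ^ b := by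
  simp [br]

theorem sum_even_mem_invariants (w : MvPolynomial (Fin 2) K) :
    br (psi K w) ∈ invariants 4 K := by
  have hz : ∀ i, (![1, -1, -1] i : PolyRing 4 K) ^ 2 = 1 := by
    intro i; fin_cases i <;> simp
  have e : ∀ i, aeval ![xx K i, zz K i] (psi K w) = aeval ![xx K i, zz K i ^ 2] w := by
    intro i
    rw [psi, aeval_eq_bind₁ ![X 0, X 1 ^ 2], aeval_bind₁]
    congr 2
    funext j
    fin_cases j <;> simp
  have hact : ∀ (σ : Equiv.Perm (Fin 4)) (i j : Fin 3), act K σ (xx K i) = xx K j →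
      act K σ (zz K i ^ 2) = zz K j ^ 2 →
      act K σ (aeval ![xx K i, zz K i ^ 2] w) = aeval ![xx K j, zz K j ^ 2] w := by
    intro σ i j hx hz
    rw [← AlgHom.comp_apply, comp_aeval]
    congr 2
    funext k
    fin_cases k <;> simp [hx, ← hz]
  simp only [br, e, Fin.sum_univ_three]
  refine mem_invariants_of_adjacent K ?_ ?_ ?_
  · have h := fun i ↦ hact (Equiv.swap 0 1) i _ (act_swap_zero_one K i).1
      (by rw [map_pow, (act_swap_zero_one K i).2, mul_pow, hz, one_mul])
    simp only [map_add, h, Matrix.cons_val]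
    ring
  · have h := fun i ↦ hact (Equiv.swap 1 2) i _ (act_swap_one_two K i).1
      (by rw [map_pow, (act_swap_one_two K i).2])
    simp only [map_add, h, Matrix.cons_val]
    ring
  · have h := fun i ↦ hact (Equiv.swap 2 3) i _ (act_swap_two_three K i).1
      (by rw [map_pow, (act_swap_two_three K i).2])
    simp only [map_add, h, Matrix.cons_val]
    ring

theorem zprod_mem_invariants : zprod K ∈ invariants 4 K := by
  refine mem_invariants_of_adjacent K ?_ ?_ ?_ <;>
    simp only [zprod, map_mul, (act_swap_zero_one K _).2, (act_swap_one_two K _).2,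
      (act_swap_two_three K _).2, Matrix.cons_val] <;> ring

/-- The values of `φ` at the ten variables are the ten generators. -/
theorem range_phi : (phi K).range = Algebra.adjoin K (generators K) := by
  rw [phi, ← Algebra.adjoin_range_eq_range_aeval]
  congr 1
  ext f
  simp only [generators, Set.mem_range, Set.mem_insert_iff, Set.mem_singleton_iff]
  constructor
  · rintro ⟨_ | _, rfl⟩
    · rename_i w
      cases w <;> simp [psi, Word.toPoly, ← pow_mul]
    · simp
  · rintro (rfl | rfl | rfl | rfl | rfl | rfl | rfl | rfl | rfl | rfl)
    · exact ⟨.T .x, by simp [psi, Word.toPoly]⟩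
    · exact ⟨.T .x2, by simp [psi, Word.toPoly]⟩
    · exact ⟨.T .x3, by simp [psi, Word.toPoly]⟩
    · exact ⟨.T .y, by simp [psi, Word.toPoly]⟩
    · exact ⟨.T .y2, by simp [psi, Word.toPoly, ← pow_mul]⟩
    · exact ⟨.T .y3, by simp [psi, Word.toPoly, ← pow_mul]⟩
    · exact ⟨.T .xy, by simp [psi, Word.toPoly]⟩
    · exact ⟨.T .x2y, by simp [psi, Word.toPoly]⟩
    · exact ⟨.T .xy2, by simp [psi, Word.toPoly, ← pow_mul]⟩
    · exact ⟨.S, rfl⟩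

theorem range_phi_le : (phi K).range ≤ invariants 4 K := by
  rw [phi, ← Algebra.adjoin_range_eq_range_aeval, Algebra.adjoin_le_iff]
  rintro _ ⟨_ | _, rfl⟩
  · exact sum_even_mem_invariants K _
  · exact zprod_mem_invariants K

theorem powerSum_mem_adjoin (h2 : (2 : K) ≠ 0) (h3 : (3 : K) ≠ 0) (a b : ℕ) :
    ∑ i, xx K i ^ a * (zz K i ^ 2) ^ b ∈ Algebra.adjoin K (generators K) := by
  refine sum_pow_mul_pow_mem h2 h3 _ (fun i ↦ zz K i ^ 2) _ (fun a b hab ↦ ?_) a b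
  have e : ∑ i, xx K i ^ a * (zz K i ^ 2) ^ b = br (X 0 ^ a * X 1 ^ (2 * b)) := by
    rw [br_monomial]
    simp only [pow_mul]
  rw [e]
  obtain ⟨rfl, rfl⟩ | hab0 : a = 0 ∧ b = 0 ∨ a + b ≠ 0 := by omega
  · have : br (X 0 ^ 0 * X 1 ^ (2 * 0) : MvPolynomial (Fin 2) K) = 3 := by
      rw [br_monomial]
      simp
    rw [this]
    exact Subalgebra.natCast_mem _ 3
  apply Algebra.subset_adjoin
  have ha : a ≤ 3 := by omega
  have hb : b ≤ 3 := by omega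
  interval_cases a <;> interval_cases b <;> first | omega | simp [generators]

/-- The sum of the images of `f` under the Klein four-group, whose elements change the signs of
an even number of the `zᵢ`. -/
noncomputable def kleinSum (f : PolyRing 4 K) : PolyRing 4 K :=
  let α := act K (Equiv.swap 1 2)
  let β := act K (Equiv.swap 2 3)
  let γ := act K (Equiv.swap 0 1)
  f + γ (β f) + α (γ (β (α f))) + γ (β (α (γ (β (α f)))))

/-- The sum of the images of `f` under the stabilizer of the label `0`, which permutes the three
pairs `(xᵢ, zᵢ)`. -/
noncomputable def symSum (f : PolyRing 4 K) : PolyRing 4 K :=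
  let α := act K (Equiv.swap 1 2)
  let β := act K (Equiv.swap 2 3)
  f + α f + β f + α (β f) + β (α f) + α (β (α f))

/-- The monomial in the `xᵢ` and `zᵢ` with exponents `s` and `t`. -/
noncomputable def monXZ (s t : Fin 3 → ℕ) : PolyRing 4 K :=
  (xx K 0 ^ s 0 * zz K 0 ^ t 0) * (xx K 1 ^ s 1 * zz K 1 ^ t 1) * (xx K 2 ^ s 2 * zz K 2 ^ t 2)

theorem kleinSum_monXZ (s t : Fin 3 → ℕ) :
    kleinSum K (monXZ K s t) = (1 + (-1) ^ t 1 * (-1) ^ t 2 + (-1) ^ t 0 * (-1) ^ t 2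
      + (-1) ^ t 0 * (-1) ^ t 1) * monXZ K s t := by
  simp only [kleinSum, monXZ, map_mul, map_pow, map_neg, (act_swap_one_two K _).1,
    (act_swap_one_two K _).2, (act_swap_two_three K _).1, (act_swap_two_three K _).2,
    (act_swap_zero_one K _).1, (act_swap_zero_one K _).2, Matrix.cons_val, neg_mul, one_mul]
  rw [neg_pow (zz K 0) (t 0), neg_pow (zz K 1) (t 1), neg_pow (zz K 2) (t 2)]
  ring

theorem symSum_monXZ_even_mem (h2 : (2 : K) ≠ 0) (h3 : (3 : K) ≠ 0) (s k : Fin 3 → ℕ) :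
    symSum K (monXZ K s (fun i ↦ 2 * k i)) ∈ Algebra.adjoin K (generators K) := by
  set 𝒜 := Algebra.adjoin K (generators K)
  have hp : ∀ a b, ∑ i, xx K i ^ a * (zz K i ^ 2) ^ b ∈ 𝒜 := powerSum_mem_adjoin K h2 h3
  have e2 : (2 : PolyRing 4 K) ∈ 𝒜 := 𝒜.natCast_mem 2
  have hmul : ∀ a b c d : ℕ, ∀ i, xx K i ^ a * (zz K i ^ 2) ^ b * (xx K i ^ c * (zz K i ^ 2) ^ d)
      = xx K i ^ (a + c) * (zz K i ^ 2) ^ (b + d) := fun a b c d i ↦ by ring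
  have key := sum_perm_mul_three (fun i ↦ xx K i ^ s 0 * (zz K i ^ 2) ^ k 0)
    (fun i ↦ xx K i ^ s 1 * (zz K i ^ 2) ^ k 1) (fun i ↦ xx K i ^ s 2 * (zz K i ^ 2) ^ k 2)
  simp only [hmul] at key
  have e : symSum K (monXZ K s (fun i ↦ 2 * k i)) = _ := Eq.trans ?_ key
  · rw [e]
    refine 𝒜.add_mem (𝒜.sub_mem ?_ ?_) (𝒜.mul_mem e2 (hp _ _))
    · exact 𝒜.mul_mem (𝒜.mul_mem (hp _ _) (hp _ _)) (hp _ _)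
    · exact 𝒜.add_mem (𝒜.add_mem (𝒜.mul_mem (hp _ _) (hp _ _)) (𝒜.mul_mem (hp _ _) (hp _ _)))
        (𝒜.mul_mem (hp _ _) (hp _ _))
  · simp only [symSum, monXZ, map_mul, map_pow, (act_swap_one_two K _).1,
      (act_swap_one_two K _).2, (act_swap_two_three K _).1, (act_swap_two_three K _).2,
      Matrix.cons_val, pow_mul]
    ring

theorem symSum_zprod_mul (f : PolyRing 4 K) : symSum K (zprod K * f) = zprod K * symSum K f := by
  simp only [symSum, zprod, map_mul, (act_swap_one_two K _).2, (act_swap_two_three K _).2,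
    Matrix.cons_val]
  ring

theorem symSum_four_mul (f : PolyRing 4 K) : symSum K (4 * f) = 4 * symSum K f := by
  simp only [symSum, map_mul, map_ofNat]
  ring

/-- The Klein four-group annihilates the monomials in which the exponents of the `zᵢ` do not have
the same parity; symmetrizing the others under permutations of the three indices yields polynomials
in power sums, up to a factor `z₁ z₂ z₃`. -/
theorem symSum_kleinSum_monXZ_mem (h2 : (2 : K) ≠ 0) (h3 : (3 : K) ≠ 0) (s t : Fin 3 → ℕ) :
    symSum K (kleinSum K (monXZ K s t)) ∈ Algebra.adjoin K (generators K) := by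
  set 𝒜 := Algebra.adjoin K (generators K)
  have hz : zprod K ∈ 𝒜 := Algebra.subset_adjoin (by simp [generators])
  have e4 : (4 : PolyRing 4 K) ∈ 𝒜 := 𝒜.natCast_mem 4
  rw [kleinSum_monXZ]
  have hsplit : (∃ k : Fin 3 → ℕ, t = fun i ↦ 2 * k i) ∨
      (∃ k : Fin 3 → ℕ, t = fun i ↦ 2 * k i + 1) ∨
      (1 + (-1) ^ t 1 * (-1) ^ t 2 + (-1) ^ t 0 * (-1) ^ t 2 + (-1) ^ t 0 * (-1) ^ t 1 :
        PolyRing 4 K) = 0 := by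
    obtain ⟨k₀, h₀ | h₀⟩ := Nat.even_or_odd' (t 0) <;>
    obtain ⟨k₁, h₁ | h₁⟩ := Nat.even_or_odd' (t 1) <;>
    obtain ⟨k₂, h₂ | h₂⟩ := Nat.even_or_odd' (t 2)
    · exact .inl ⟨![k₀, k₁, k₂], by funext i; fin_cases i <;> simp [h₀, h₁, h₂]⟩
    · exact .inr (.inr (by simp [h₀, h₁, h₂, pow_succ, pow_mul]))
    · exact .inr (.inr (by simp [h₀, h₁, h₂, pow_succ, pow_mul]))
    · exact .inr (.inr (by simp [h₀, h₁, h₂, pow_succ, pow_mul]))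
    · exact .inr (.inr (by simp [h₀, h₁, h₂, pow_succ, pow_mul]))
    · exact .inr (.inr (by simp [h₀, h₁, h₂, pow_succ, pow_mul]))
    · exact .inr (.inr (by simp [h₀, h₁, h₂, pow_succ, pow_mul]))
    · exact .inr (.inl ⟨![k₀, k₁, k₂], by funext i; fin_cases i <;> simp [h₀, h₁, h₂]⟩)
  obtain ⟨k, rfl⟩ | ⟨k, rfl⟩ | h := hsplit
  · have : (1 + (-1) ^ (2 * k 1) * (-1) ^ (2 * k 2) + (-1) ^ (2 * k 0) * (-1) ^ (2 * k 2)
        + (-1) ^ (2 * k 0) * (-1) ^ (2 * k 1) : PolyRing 4 K) = 4 := by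
      norm_num [pow_mul]
    rw [this, symSum_four_mul]
    exact 𝒜.mul_mem e4 (symSum_monXZ_even_mem K h2 h3 s k)
  · have : (1 + (-1) ^ (2 * k 1 + 1) * (-1) ^ (2 * k 2 + 1)
        + (-1) ^ (2 * k 0 + 1) * (-1) ^ (2 * k 2 + 1)
        + (-1) ^ (2 * k 0 + 1) * (-1) ^ (2 * k 1 + 1) : PolyRing 4 K) = 4 := by
      norm_num [pow_mul, pow_succ]
    have hm : monXZ K s (fun i ↦ 2 * k i + 1) = zprod K * monXZ K s (fun i ↦ 2 * k i) := by
      simp only [monXZ, zprod]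
      ring
    rw [this, symSum_four_mul, hm, symSum_zprod_mul]
    exact 𝒜.mul_mem e4 (𝒜.mul_mem hz (symSum_monXZ_even_mem K h2 h3 s k))
  · rw [h, zero_mul, show symSum K 0 = 0 by simp [symSum]]
    exact 𝒜.zero_mem

theorem symSum_kleinSum_mem (h2 : (2 : K) ≠ 0) (h3 : (3 : K) ≠ 0) (f : PolyRing 4 K) :
    symSum K (kleinSum K f) ∈ Algebra.adjoin K (generators K) := by
  obtain ⟨g, rfl⟩ := aeval_xx_zz_surjective K h2 f
  induction g using MvPolynomial.induction_on' with
  | monomial u c =>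
    have e : aeval (Sum.elim (xx K) (zz K)) (monomial u c) =
        c • monXZ K (fun i ↦ u (.inl i)) (fun i ↦ u (.inr i)) := by
      rw [aeval_monomial, Finsupp.prod_fintype _ _ (fun _ ↦ pow_zero _), Fintype.prod_sum_type,
        Algebra.smul_def]
      simp only [Fin.prod_univ_three, Sum.elim_inl, Sum.elim_inr, monXZ]
      ring
    have e' : ∀ f, symSum K (kleinSum K (c • f)) = c • symSum K (kleinSum K f) := by
      intro f
      simp only [symSum, kleinSum, map_smul, map_add, smul_add]
    rw [e, e']
    exact Subalgebra.smul_mem _ (symSum_kleinSum_monXZ_mem K h2 h3 _ _) c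
  | add p q hp hq =>
    have e : ∀ f g, symSum K (kleinSum K (f + g)) =
        symSum K (kleinSum K f) + symSum K (kleinSum K g) := by
      intro f g
      simp only [symSum, kleinSum, map_add]
      abel
    rw [map_add, e]
    exact Subalgebra.add_mem _ hp hq

theorem invariants_le_adjoin (h2 : (2 : K) ≠ 0) (h3 : (3 : K) ≠ 0) :
    invariants 4 K ≤ Algebra.adjoin K (generators K) := by
  intro f hf
  have h24 := symSum_kleinSum_mem K h2 h3 f
  have e24 : symSum K (kleinSum K f) = (24 : K) • f := by
    simp only [symSum, kleinSum, map_add, hf _]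
    rw [Algebra.smul_def, map_ofNat]
    ring
  rw [e24] at h24
  have h0 : (24 : K) ≠ 0 := by
    rw [show (24 : K) = 2 ^ 3 * 3 by norm_num]
    exact mul_ne_zero (pow_ne_zero 3 h2) h3
  simpa [smul_smul, inv_mul_cancel₀ h0] using Subalgebra.smul_mem _ h24 (24 : K)⁻¹

theorem adjoin_generators (h2 : (2 : K) ≠ 0) (h3 : (3 : K) ≠ 0) :
    Algebra.adjoin K (generators K) = invariants 4 K :=
  le_antisymm (range_phi K ▸ range_phi_le K) (invariants_le_adjoin K h2 h3)

end Generators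

/-! ### The relations hold, and none is redundant -/

section Relations

variable {K : Type*} [Field K] {A : Type*} [CommRing A] [Algebra K A]

/-- The power sum `∑ xᵢᵃ yᵢᵇ` belonging to the monomial `xᵃ yᵇ`. -/
def powerSum (x y : Fin 3 → A) : Word → A
  | .x => ∑ i, x i
  | .x2 => ∑ i, x i ^ 2
  | .x3 => ∑ i, x i ^ 3
  | .y => ∑ i, y i
  | .y2 => ∑ i, y i ^ 2
  | .y3 => ∑ i, y i ^ 3
  | .xy => ∑ i, x i * y i
  | .x2y => ∑ i, x i ^ 2 * y i
  | .xy2 => ∑ i, x i * y i ^ 2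

/-- The homomorphism that sends each `T_w` to the corresponding power sum of three pairs `(xᵢ, yᵢ)`
and `S` to `s`. The homomorphism `φ` is the case `yᵢ = zᵢ²`, `s = z₁ z₂ z₃`. -/
noncomputable def powerSumHom (x y : Fin 3 → A) (s : A) : FreeAlg K →ₐ[K] A :=
  aeval fun v : Var ↦ match v with
    | .T w => powerSum x y w
    | .S => s

@[simp]
theorem powerSumHom_T (x y : Fin 3 → A) (s : A) (w : Word) :
    powerSumHom x y s (T K w) = powerSum x y w := by
  simp [powerSumHom, T]

@[simp]
theorem powerSumHom_S (x y : Fin 3 → A) (s : A) : powerSumHom x y s (S K) = s := by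
  simp [powerSumHom, S]

theorem freeAlg_hom_ext {f g : FreeAlg K →ₐ[K] A} (hT : ∀ w, f (T K w) = g (T K w))
    (hS : f (S K) = g (S K)) : f = g := by
  apply MvPolynomial.algHom_ext
  rintro (w | _)
  exacts [hT w, hS]

theorem phi_eq_powerSumHom : phi K = powerSumHom (xx K) (fun i ↦ zz K i ^ 2) (zprod K) := by
  apply freeAlg_hom_ext
  · intro w
    rw [powerSumHom_T]
    cases w <;> simp [phi, T, br, psi, Word.toPoly, powerSum]
  · rw [powerSumHom_S]
    simp [phi, S]

/-- The six relations hold for the power sums of any three pairs, when `s² = y₀ y₁ y₂`. -/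
theorem powerSumHom_rels (h2 : (2 : K) ≠ 0) (h3 : (3 : K) ≠ 0) (x y : Fin 3 → A) (s : A)
    (hs : s ^ 2 = y 0 * y 1 * y 2) (i : Fin 6) : powerSumHom x y s (rels K i) = 0 := by
  fin_cases i
  · have e2 : algebraMap K A 2⁻¹ * 2 = 1 := by
      rw [show (2 : A) = algebraMap K A 2 from (map_ofNat _ 2).symm, ← map_mul,
        inv_mul_cancel₀ h2, map_one]
    have e3 : algebraMap K A 3⁻¹ * 3 = 1 := by
      rw [show (3 : A) = algebraMap K A 3 from (map_ofNat _ 3).symm, ← map_mul,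
        inv_mul_cancel₀ h3, map_one]
    have e6 : (1 / 6 : K) = 2⁻¹ * 3⁻¹ := by
      rw [one_div, ← mul_inv]; norm_num
    have hC : ∀ r : K, powerSumHom x y s (C r) = algebraMap K A r := fun r ↦ AlgHom.commutes _ r
    simp only [rels, newtonRel, Fin.zero_eta, Matrix.cons_val, map_sub, map_add, map_mul, map_pow,
      powerSumHom_T, powerSumHom_S, hC, e6, one_div]
    simp only [powerSum, Fin.sum_univ_three, hs]
    generalize algebraMap K A 2⁻¹ = u at *
    generalize algebraMap K A 3⁻¹ = v at *
    linear_combination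
      (v * (y 0 ^ 3 + y 1 ^ 3 + y 2 ^ 3) - 3 * v * (y 0 * y 1 * y 2)) * e2
      - (y 0 * y 1 * y 2 + u * (y 0 ^ 2 + y 1 ^ 2 + y 2 ^ 2) * (y 0 + y 1 + y 2)) * e3
  · simp only [rels, J32, Fin.mk_one, Matrix.cons_val, map_sub, map_add, map_mul, map_pow,
      map_ofNat, powerSumHom_T, powerSum, Fin.sum_univ_three]
    ring
  · simp only [rels, J23, Fin.reduceFinMk, Matrix.cons_val, map_sub, map_add, map_mul, map_pow,
      map_ofNat, powerSumHom_T, powerSum, Fin.sum_univ_three]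
    ring
  · simp only [rels, J42, Fin.reduceFinMk, Matrix.cons_val, map_sub, map_add, map_mul, map_pow,
      map_ofNat, powerSumHom_T, powerSum, Fin.sum_univ_three]
    ring
  · simp only [rels, J33, Fin.reduceFinMk, Matrix.cons_val, map_sub, map_add, map_mul, map_pow,
      map_ofNat, powerSumHom_T, powerSum, Fin.sum_univ_three]
    ring
  · simp only [rels, J24, Fin.reduceFinMk, Matrix.cons_val, map_sub, map_add, map_mul, map_pow,
      map_ofNat, powerSumHom_T, powerSum, Fin.sum_univ_three]
    ring

/-- A point at which one member of a family does not vanish and all others do shows that this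
member is not in the ideal generated by the others. -/
theorem not_mem_span_of_eval {g : Fin 6 → FreeAlg K} {i : Fin 6} (v : Var → K)
    (hi : aeval v (g i) ≠ 0) (h : ∀ j, j ≠ i → aeval v (g j) = 0) :
    g i ∉ Ideal.span (g '' {i}ᶜ) := by
  intro hmem
  have hle : Ideal.span (g '' {i}ᶜ) ≤ RingHom.ker (aeval v : FreeAlg K →ₐ[K] K) := by
    rw [Ideal.span_le]
    rintro _ ⟨j, hj, rfl⟩
    exact h j hj
  exact hi (hle hmem)

set_option maxHeartbeats 1000000 in
/-- No relation is redundant: for each there is a point at which the other five vanish and it does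
not. -/
theorem rels_not_mem (h2 : (2 : K) ≠ 0) (h3 : (3 : K) ≠ 0) (i : Fin 6) :
    rels K i ∉ Ideal.span (rels K '' {i}ᶜ) := by
  have h6 : (6 : K) ≠ 0 := by
    rw [show (6 : K) = 2 * 3 by norm_num]
    exact mul_ne_zero h2 h3
  have h9 : (3 : K) * 3 ≠ 0 := mul_ne_zero h3 h3
  fin_cases i
  · refine not_mem_span_of_eval (fun | .S => 1 | .T _ => 0) ?_ ?_
    · simp [rels, newtonRel, S, T]
    · intro j hj
      fin_cases j
      · exact absurd rfl hj
      all_goals simp [rels, J32, J23, J42, J33, J24, T]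
  · refine not_mem_span_of_eval (fun | .T .x3 => 1 | .T .y2 => 1 | _ => 0) ?_ ?_
    · simp [rels, J32, T, h3]
    · intro j hj
      fin_cases j
      · simp [rels, newtonRel, S, T]
      · exact absurd rfl hj
      all_goals simp [rels, J23, J42, J33, J24, T]
  -- where `T_{y³} ≠ 0`, the first relation vanishes only with `S ≠ 0`; `T_{y³} = 3`, `S = 1` will do
  · refine not_mem_span_of_eval (fun | .T .x2 => 1 | .T .y3 => 3 | .S => 1 | _ => 0) ?_ ?_
    · simp [rels, J23, T, h3]
    · intro j hj
      fin_cases j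
      · simp [rels, newtonRel, S, T, h3]
      · simp [rels, J32, T]
      · exact absurd rfl hj
      all_goals simp [rels, J42, J33, J24, T]
  · refine not_mem_span_of_eval (fun | .T .x2y => 1 | _ => 0) ?_ ?_
    · simp [rels, J42, T, h6]
    · intro j hj
      fin_cases j
      · simp [rels, newtonRel, S, T]
      · simp [rels, J32, T]
      · simp [rels, J23, T]
      · exact absurd rfl hj
      all_goals simp [rels, J33, J24, T]
  · refine not_mem_span_of_eval (fun | .T .x3 => 1 | .T .y3 => 3 | .S => 1 | _ => 0) ?_ ?_
    · simp [rels, J33, T, h3]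
    · intro j hj
      fin_cases j
      · simp [rels, newtonRel, S, T, h3]
      · simp [rels, J32, T]
      · simp [rels, J23, T]
      · simp [rels, J42, T]
      · exact absurd rfl hj
      · simp [rels, J24, T]
  · refine not_mem_span_of_eval (fun | .T .xy2 => 1 | _ => 0) ?_ ?_
    · simp [rels, J24, T, h6]
    · intro j hj
      fin_cases j
      · simp [rels, newtonRel, S, T]
      · simp [rels, J32, T]
      · simp [rels, J23, T]
      · simp [rels, J42, T]
      · simp [rels, J33, T]
      · exact absurd rfl hj

end Relations

/-! ### A spanning set modulo the relations -/

section NormalForm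

variable {P A : Type*} [CommRing P] [CommRing A] [Algebra P A]

/-- The module generators `1, a, b, c, a², a³`. -/
def basisVec (a b c : A) : Fin 6 → A := ![1, a, b, c, a ^ 2, a ^ 3]

theorem mem_of_unit_smul_mem {N : Submodule P A} {r : P} (hr : IsUnit r) {n : A}
    (h : r • n ∈ N) : n ∈ N := by
  obtain ⟨u, rfl⟩ := hr
  simpa [smul_smul] using N.smul_mem (↑u⁻¹ : P) h

/-- Let `f` be a homomorphism that annihilates the six relations, such that the images of the `T_w`
belonging to the pure powers of `x` and `y` come from a ring `P`. With `a, b, c` the images of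
`T_{xy}, T_{x²y}, T_{xy²}`, the span of `1, a, b, c, a², a³` over `P` is closed under multiplication
by `a`, `b` and `c`. The five `J` express `ab, ac, b², c², bc`; the expression of `a⁴` comes from
the combination `2 a J₃₃ - c J₃₂`, in which the product `abc` cancels. -/
theorem mul_mem_span_basisVec {K : Type*} [Field K] [Algebra K A] (u2 : IsUnit (2 : P))
    (u3 : IsUnit (3 : P)) (f : FreeAlg K →ₐ[K] A) (hf : ∀ i, f (rels K i) = 0)
    {x₁ x₂ x₃ y₁ y₂ y₃ : P} (hx₁ : f (T K .x) = algebraMap P A x₁)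
    (hx₂ : f (T K .x2) = algebraMap P A x₂) (hx₃ : f (T K .x3) = algebraMap P A x₃)
    (hy₁ : f (T K .y) = algebraMap P A y₁) (hy₂ : f (T K .y2) = algebraMap P A y₂)
    (hy₃ : f (T K .y3) = algebraMap P A y₃) {a b c : A} (ha : f (T K .xy) = a)
    (hb : f (T K .x2y) = b) (hc : f (T K .xy2) = c) {n : A}
    (hn : n ∈ Submodule.span P (Set.range (basisVec a b c))) :
    a * n ∈ Submodule.span P (Set.range (basisVec a b c)) ∧
    b * n ∈ Submodule.span P (Set.range (basisVec a b c)) ∧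
    c * n ∈ Submodule.span P (Set.range (basisVec a b c)) := by
  have h32 := hf 1
  have h23 := hf 2
  have h42 := hf 3
  have h33 := hf 4
  have h24 := hf 5
  simp only [rels, Matrix.cons_val, J32, J23, J42, J33, J24, map_add, map_sub, map_mul, map_pow,
    map_ofNat, hx₁, hx₂, hx₃, hy₁, hy₂, hy₃, ha, hb, hc] at h32 h23 h42 h33 h24
  clear hx₁ hx₂ hx₃ hy₁ hy₂ hy₃ ha hb hc hf
  set N := Submodule.span P (Set.range (basisVec a b c)) with hN
  have u6 : IsUnit (6 : P) := by
    rw [show (6 : P) = 2 * 3 by norm_num]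
    exact u2.mul u3
  have m0 : (1 : A) ∈ N := Submodule.subset_span ⟨0, rfl⟩
  have m1 : a ∈ N := Submodule.subset_span ⟨1, rfl⟩
  have m2 : b ∈ N := Submodule.subset_span ⟨2, rfl⟩
  have m3 : c ∈ N := Submodule.subset_span ⟨3, rfl⟩
  have m4 : a ^ 2 ∈ N := Submodule.subset_span ⟨4, rfl⟩
  have m5 : a ^ 3 ∈ N := Submodule.subset_span ⟨5, rfl⟩
  have e32 : (6 : P) • (a * b) = (3 * x₂ - x₁ ^ 2) • c + (2 * x₁ * y₁) • b + (4 * x₁) • a ^ 2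
      + (-2 * x₁ ^ 2 * y₁) • a + (3 * x₃ * y₂ - 4 * x₂ * x₁ * y₂ + x₁ ^ 3 * y₂ - x₃ * y₁ ^ 2
        + x₂ * x₁ * y₁ ^ 2) • (1 : A) := by
    simp only [Algebra.smul_def, map_add, map_sub, map_mul, map_pow, map_ofNat, map_neg]
    linear_combination h32
  have e23 : (6 : P) • (a * c) = (3 * y₂ - y₁ ^ 2) • b + (2 * y₁ * x₁) • c + (4 * y₁) • a ^ 2
      + (-2 * y₁ ^ 2 * x₁) • a + (3 * y₃ * x₂ - 4 * y₂ * y₁ * x₂ + y₁ ^ 3 * x₂ - y₃ * x₁ ^ 2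
        + y₂ * y₁ * x₁ ^ 2) • (1 : A) := by
    simp only [Algebra.smul_def, map_add, map_sub, map_mul, map_pow, map_ofNat, map_neg]
    linear_combination h23
  have hab : a * b ∈ N := by
    refine mem_of_unit_smul_mem u6 ?_
    rw [e32]
    repeat' apply N.add_mem
    all_goals apply N.smul_mem; assumption
  have hac : a * c ∈ N := by
    refine mem_of_unit_smul_mem u6 ?_
    rw [e23]
    repeat' apply N.add_mem
    all_goals apply N.smul_mem; assumption
  have haab : a * (a * b) ∈ N := by
    refine mem_of_unit_smul_mem u6 ?_
    have e : (6 : P) • (a * (a * b)) = (3 * x₂ - x₁ ^ 2) • (a * c) + (2 * x₁ * y₁) • (a * b)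
        + (4 * x₁) • a ^ 3 + (-2 * x₁ ^ 2 * y₁) • a ^ 2 + (3 * x₃ * y₂ - 4 * x₂ * x₁ * y₂
          + x₁ ^ 3 * y₂ - x₃ * y₁ ^ 2 + x₂ * x₁ * y₁ ^ 2) • a := by
      simp only [Algebra.smul_def, map_add, map_sub, map_mul, map_pow, map_ofNat, map_neg]
      linear_combination a * h32
    rw [e]
    repeat' apply N.add_mem
    all_goals apply N.smul_mem; assumption
  have haac : a * (a * c) ∈ N := by
    refine mem_of_unit_smul_mem u6 ?_
    have e : (6 : P) • (a * (a * c)) = (3 * y₂ - y₁ ^ 2) • (a * b) + (2 * y₁ * x₁) • (a * c)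
        + (4 * y₁) • a ^ 3 + (-2 * y₁ ^ 2 * x₁) • a ^ 2 + (3 * y₃ * x₂ - 4 * y₂ * y₁ * x₂
          + y₁ ^ 3 * x₂ - y₃ * x₁ ^ 2 + y₂ * y₁ * x₁ ^ 2) • a := by
      simp only [Algebra.smul_def, map_add, map_sub, map_mul, map_pow, map_ofNat, map_neg]
      linear_combination a * h23
    rw [e]
    repeat' apply N.add_mem
    all_goals apply N.smul_mem; assumption
  have hbb : b * b ∈ N := by
    refine mem_of_unit_smul_mem u6 ?_
    have e : (6 : P) • (b * b) = (3 * x₁ ^ 2 - x₂) • a ^ 2 + (6 * x₃ - 2 * x₂ * x₁) • c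
        + (-4 * x₃ * y₁ + 2 * x₂ * x₁ * y₁ - 2 * x₁ ^ 3 * y₁) • a + (4 * x₂ * y₁) • b
        + (x₂ ^ 2 * y₂ - x₂ ^ 2 * y₁ ^ 2 - 4 * x₂ * x₁ ^ 2 * y₂ + x₂ * x₁ ^ 2 * y₁ ^ 2
          + x₁ ^ 4 * y₂ + 2 * x₃ * x₁ * y₂) • (1 : A) := by
      simp only [Algebra.smul_def, map_add, map_sub, map_mul, map_pow, map_ofNat, map_neg]
      linear_combination h42
    rw [e]
    repeat' apply N.add_mem
    all_goals apply N.smul_mem; assumption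
  have hcc : c * c ∈ N := by
    refine mem_of_unit_smul_mem u6 ?_
    have e : (6 : P) • (c * c) = (3 * y₁ ^ 2 - y₂) • a ^ 2 + (6 * y₃ - 2 * y₂ * y₁) • b
        + (-4 * y₃ * x₁ + 2 * y₂ * y₁ * x₁ - 2 * y₁ ^ 3 * x₁) • a + (4 * y₂ * x₁) • c
        + (y₂ ^ 2 * x₂ - y₂ ^ 2 * x₁ ^ 2 - 4 * y₂ * y₁ ^ 2 * x₂ + y₂ * y₁ ^ 2 * x₁ ^ 2
          + y₁ ^ 4 * x₂ + 2 * y₃ * y₁ * x₂) • (1 : A) := by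
      simp only [Algebra.smul_def, map_add, map_sub, map_mul, map_pow, map_ofNat, map_neg]
      linear_combination h24
    rw [e]
    repeat' apply N.add_mem
    all_goals apply N.smul_mem; assumption
  have hbc : b * c ∈ N := by
    refine mem_of_unit_smul_mem u3 ?_
    have e : (3 : P) • (b * c) = (x₂ * y₂ - x₁ ^ 2 * y₂ - x₂ * y₁ ^ 2 - 2 * x₁ ^ 2 * y₁ ^ 2) • a
        + (-1 : P) • a ^ 3 + (5 * x₁ * y₁) • a ^ 2 + (-2 * x₁) • (a * c) + (-2 * y₁) • (a * b)
        + (3 * x₂ * y₁) • c + (3 * x₁ * y₂) • b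
        + (3 * x₃ * y₃ - x₂ * x₁ * y₃ - 3 * x₂ * x₁ * y₂ * y₁ - x₃ * y₂ * y₁ + x₁ ^ 3 * y₂ * y₁
          + x₂ * x₁ * y₁ ^ 3) • (1 : A) := by
      simp only [Algebra.smul_def, map_add, map_sub, map_mul, map_pow, map_ofNat, map_neg, map_one]
      linear_combination h33
    rw [e]
    repeat' apply N.add_mem
    all_goals apply N.smul_mem; assumption
  have ha4 : a * a ^ 3 ∈ N := by
    refine mem_of_unit_smul_mem u2 ?_
    have e : (2 : P) • (a * a ^ 3) =
        (2 * x₂ * y₂ - 2 * x₁ ^ 2 * y₂ - 2 * x₂ * y₁ ^ 2 - 4 * x₁ ^ 2 * y₁ ^ 2) • a ^ 2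
        + (10 * x₁ * y₁) • a ^ 3
        + (6 * x₃ * y₃ - 2 * x₂ * x₁ * y₃ - 6 * x₂ * x₁ * y₂ * y₁ - 2 * x₃ * y₂ * y₁
          + 2 * x₁ ^ 3 * y₂ * y₁ + 2 * x₂ * x₁ * y₁ ^ 3) • a
        + (-8 * x₁) • (a * (a * c)) + (6 * x₂ * y₁ + 2 * x₁ ^ 2 * y₁) • (a * c)
        + (-4 * y₁) • (a * (a * b)) + (6 * x₁ * y₂) • (a * b)
        + (-3 * x₂ + x₁ ^ 2) • (c * c) + (-2 * x₁ * y₁) • (b * c)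
        + (-(3 * x₃ * y₂ - 4 * x₂ * x₁ * y₂ + x₁ ^ 3 * y₂ - x₃ * y₁ ^ 2 + x₂ * x₁ * y₁ ^ 2)) • c
        := by
      simp only [Algebra.smul_def, map_add, map_sub, map_mul, map_pow, map_ofNat, map_neg]
      linear_combination 2 * a * h33 - c * h32
    rw [e]
    repeat' apply N.add_mem
    all_goals apply N.smul_mem; assumption
  have closed : ∀ d : A, (∀ i, d * basisVec a b c i ∈ N) → ∀ n ∈ N, d * n ∈ N := by
    intro d hd n hn
    induction hn using Submodule.span_induction with
    | mem n hn =>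
      obtain ⟨i, rfl⟩ := hn
      exact hd i
    | zero => simp
    | add m n _ _ hm hn => rw [mul_add]; exact N.add_mem hm hn
    | smul r n _ hn => rw [mul_smul_comm]; exact N.smul_mem r hn
  have hA : ∀ n ∈ N, a * n ∈ N := by
    refine closed a (fun i ↦ ?_)
    fin_cases i
    · simpa [basisVec] using m1
    · simpa [basisVec, ← sq] using m4
    · simpa [basisVec] using hab
    · simpa [basisVec] using hac
    · simpa [basisVec, ← pow_succ'] using m5
    · simpa [basisVec] using ha4
  have hB : ∀ n ∈ N, b * n ∈ N := by
    refine closed b (fun i ↦ ?_)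
    fin_cases i
    · simpa [basisVec] using m2
    · simpa [basisVec, mul_comm] using hab
    · simpa [basisVec] using hbb
    · simpa [basisVec] using hbc
    · convert haab using 1
      simp only [basisVec, Fin.reduceFinMk, Matrix.cons_val]
      ring
    · convert hA _ haab using 1
      simp only [basisVec, Fin.reduceFinMk, Matrix.cons_val]
      ring
  have hC : ∀ n ∈ N, c * n ∈ N := by
    refine closed c (fun i ↦ ?_)
    fin_cases i
    · simpa [basisVec] using m3
    · simpa [basisVec, mul_comm] using hac
    · simpa [basisVec, mul_comm] using hbc
    · simpa [basisVec] using hcc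
    · convert haac using 1
      simp only [basisVec, Fin.reduceFinMk, Matrix.cons_val]
      ring
    · convert hA _ haac using 1
      simp only [basisVec, Fin.reduceFinMk, Matrix.cons_val]
      ring
  exact ⟨hA n hn, hB n hn, hC n hn⟩

end NormalForm

/-! ### Linear independence over the pure power sums -/

section Independence

variable (K : Type*) [Field K]

/-- The polynomial ring in independent variables `x₀, x₁, x₂` and `z₀, z₁, z₂`. -/
abbrev XZRing : Type _ := MvPolynomial (Fin 3 ⊕ Fin 3) K

/-- The variables `xᵢ`. -/
noncomputable def xv (i : Fin 3) : XZRing K := X (.inl i)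

/-- The squares of the variables `zᵢ`. -/
noncomputable def yv (i : Fin 3) : XZRing K := X (.inr i) ^ 2

/-- The names of the pure powers of `x` and `y`. -/
def pureWord : Fin 6 → Word := ![.x, .x2, .x3, .y, .y2, .y3]

/-- The pure power sums of the `xᵢ` and of the `zᵢ²`. -/
noncomputable def purePowerSum (j : Fin 6) : XZRing K := powerSum (xv K) (yv K) (pureWord j)

variable {K}

/-- Three elements of a `K`-algebra are integral over each subalgebra that contains their first
three power sums. -/
theorem isIntegral_of_powerSums_mem {A : Type*} [CommRing A] [Algebra K A] (h2 : (2 : K) ≠ 0)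
    (h3 : (3 : K) ≠ 0) (B : Subalgebra K A) (x : Fin 3 → A) (h₁ : ∑ i, x i ∈ B)
    (h₂ : ∑ i, x i ^ 2 ∈ B) (h₃ : ∑ i, x i ^ 3 ∈ B) (i : Fin 3) : IsIntegral B (x i) := by
  have e2 : algebraMap K A 2⁻¹ * 2 = 1 := by
    rw [show (2 : A) = algebraMap K A 2 from (map_ofNat _ 2).symm, ← map_mul,
      inv_mul_cancel₀ h2, map_one]
  have e3 : algebraMap K A 3⁻¹ * 3 = 1 := by
    rw [show (3 : A) = algebraMap K A 3 from (map_ofNat _ 3).symm, ← map_mul,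
      inv_mul_cancel₀ h3, map_one]
  have hu := B.algebraMap_mem 2⁻¹
  have hv := B.algebraMap_mem 3⁻¹
  generalize algebraMap K A 2⁻¹ = u at *
  generalize algebraMap K A 3⁻¹ = v at *
  have hE2 : x 0 * x 1 + x 0 * x 2 + x 1 * x 2 ∈ B := by
    have e : x 0 * x 1 + x 0 * x 2 + x 1 * x 2 = u * ((∑ i, x i) ^ 2 - ∑ i, x i ^ 2) := by
      simp only [Fin.sum_univ_three]
      linear_combination -(x 0 * x 1 + x 0 * x 2 + x 1 * x 2) * e2
    rw [e]
    exact B.mul_mem hu (B.sub_mem (B.pow_mem h₁ 2) h₂)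
  have hE3 : x 0 * x 1 * x 2 ∈ B := by
    have e : x 0 * x 1 * x 2 = v * (∑ i, x i ^ 3 - (∑ i, x i) ^ 3
        + 3 * ((∑ i, x i) * (x 0 * x 1 + x 0 * x 2 + x 1 * x 2))) := by
      simp only [Fin.sum_univ_three]
      linear_combination -(x 0 * x 1 * x 2) * e3
    rw [e]
    exact B.mul_mem hv (B.add_mem (B.sub_mem h₃ (B.pow_mem h₁ 3))
      (B.mul_mem (B.natCast_mem 3) (B.mul_mem h₁ hE2)))
  refine ⟨Polynomial.X ^ 3 - Polynomial.C ⟨_, h₁⟩ * Polynomial.X ^ 2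
    + Polynomial.C ⟨_, hE2⟩ * Polynomial.X - Polynomial.C ⟨_, hE3⟩, by monicity!, ?_⟩
  simp only [Polynomial.eval₂_sub, Polynomial.eval₂_add, Polynomial.eval₂_mul,
    Polynomial.eval₂_pow, Polynomial.eval₂_X, Polynomial.eval₂_C]
  simp only [Subalgebra.algebraMap_apply, Fin.sum_univ_three]
  fin_cases i <;> simp only [Fin.zero_eta, Fin.mk_one, Fin.reduceFinMk] <;> ring

/-- The six pure power sums are algebraically independent: the polynomial ring in six variables is
integral over the algebra they generate. -/
theorem algebraicIndependent_purePowerSum (h2 : (2 : K) ≠ 0) (h3 : (3 : K) ≠ 0) :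
    AlgebraicIndependent K (purePowerSum K) := by
  set B := Algebra.adjoin K (Set.range (purePowerSum K)) with hB
  have hm : ∀ j, purePowerSum K j ∈ B := fun j ↦ Algebra.subset_adjoin ⟨j, rfl⟩
  have hx : ∀ i, IsIntegral B (X (.inl i) : XZRing K) :=
    isIntegral_of_powerSums_mem h2 h3 B (xv K) (hm 0) (hm 1) (hm 2)
  have hz : ∀ i, IsIntegral B (X (.inr i) : XZRing K) := fun i ↦
    IsIntegral.of_pow two_pos (isIntegral_of_powerSums_mem h2 h3 B (yv K) (hm 3) (hm 4) (hm 5) i)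
  have htop : ∀ f : XZRing K, IsIntegral B f := by
    intro f
    induction f using MvPolynomial.induction_on with
    | C r => exact isIntegral_algebraMap (R := B) (x := algebraMap K B r)
    | add p q hp hq => exact hp.add hq
    | mul_X p i hp =>
      obtain i | i := i
      exacts [hp.mul (hx i), hp.mul (hz i)]
  have : Algebra.IsAlgebraic B (XZRing K) := ⟨fun f ↦ (htop f).isAlgebraic⟩
  refine (Algebra.IsAlgebraic.isTranscendenceBasis_of_lift_le_trdeg_of_finite K (purePowerSum K) ?_).1
  rw [MvPolynomial.trdeg_of_isDomain]
  simp

/-- The mixed power sum vector `1, a, b, c, a², a³` with `a = ∑ xᵢ zᵢ²` and so on. -/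
noncomputable def mixedVec : Fin 6 → XZRing K :=
  basisVec (powerSum (xv K) (yv K) .xy) (powerSum (xv K) (yv K) .x2y) (powerSum (xv K) (yv K) .xy2)

/-- The six permutations of three indices. -/
def perms : Fin 6 → Fin 3 → Fin 3 :=
  ![![0, 1, 2], ![0, 2, 1], ![1, 0, 2], ![1, 2, 0], ![2, 0, 1], ![2, 1, 0]]

/-- The permutation of the `zᵢ` alone. -/
noncomputable def permZ (j : Fin 6) : XZRing K →ₐ[K] XZRing K := rename (Sum.map id (perms j))

theorem permZ_purePowerSum (j i : Fin 6) : permZ j (purePowerSum K i) = purePowerSum K i := by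
  fin_cases i <;> fin_cases j <;>
    simp [purePowerSum, permZ, pureWord, powerSum, xv, yv, perms, Fin.sum_univ_three] <;> ring

/-- The values of `1, a, b, c, a², a³` and its conjugates at `x = (0, 1, -1)`, `z = (0, 1, 2)`. -/
def valueMatrix : Matrix (Fin 6) (Fin 6) ℤ :=
  !![1, -3, 5, -15, 9, -27; 1, 3, 5, 15, 9, 27; 1, -4, 4, -16, 16, -64; 1, 4, 4, 16, 16, 64;
    1, -1, 1, -1, 1, -1; 1, 1, 1, 1, 1, 1]

/-- `72` times the inverse of `valueMatrix`. -/
def valueMatrixInv : Matrix (Fin 6) (Fin 6) ℤ :=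
  !![-12, -12, 4, 4, 44, 44; 4, -4, -1, 1, -44, 44; 15, 15, -8, -8, -7, -7;
    -5, 5, 2, -2, 7, -7; -3, -3, 4, 4, -1, -1; 1, -1, -1, 1, 1, -1]

theorem valueMatrix_mul : valueMatrix * valueMatrixInv = 72 := by decide

/-- The conjugates of `1, a, b, c, a², a³` under permutations of the `zᵢ` alone. -/
noncomputable def conjMatrix : Matrix (Fin 6) (Fin 6) (XZRing K) :=
  Matrix.of fun j i ↦ permZ j (mixedVec i)

/-- The evaluation at `x = (0, 1, -1)`, `z = (0, 1, 2)`. -/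
noncomputable def evalPoint : XZRing K →ₐ[K] K := aeval (Sum.elim ![0, 1, -1] ![0, 1, 2])

theorem evalPoint_conjMatrix :
    (evalPoint : XZRing K →ₐ[K] K).mapMatrix conjMatrix = valueMatrix.map (Int.cast : ℤ → K) := by
  have ha : ∀ j, evalPoint (permZ j (powerSum (xv K) (yv K) .xy)) =
      ((![-3, 3, -4, 4, -1, 1] j : ℤ) : K) := by
    intro j
    fin_cases j <;>
      simp [permZ, powerSum, xv, yv, perms, Fin.sum_univ_three, evalPoint] <;> norm_num
  have hb : ∀ j, evalPoint (permZ j (powerSum (xv K) (yv K) .x2y)) =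
      ((![5, 5, 4, 4, 1, 1] j : ℤ) : K) := by
    intro j
    fin_cases j <;>
      simp [permZ, powerSum, xv, yv, perms, Fin.sum_univ_three, evalPoint] <;> norm_num
  have hc : ∀ j, evalPoint (permZ j (powerSum (xv K) (yv K) .xy2)) =
      ((![-15, 15, -16, 16, -1, 1] j : ℤ) : K) := by
    intro j
    fin_cases j <;>
      simp [permZ, powerSum, xv, yv, perms, Fin.sum_univ_three, evalPoint] <;> norm_num
  ext j i
  rw [AlgHom.mapMatrix_apply, Matrix.map_apply, Matrix.map_apply, conjMatrix, Matrix.of_apply,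
    mixedVec]
  fin_cases i
  · simp only [basisVec, Fin.zero_eta, Matrix.cons_val, map_one]
    fin_cases j <;> simp [valueMatrix]
  · simp only [basisVec, Fin.mk_one, Matrix.cons_val, ha]
    fin_cases j <;> simp [valueMatrix]
  · simp only [basisVec, Fin.reduceFinMk, Matrix.cons_val, hb]
    fin_cases j <;> simp [valueMatrix]
  · simp only [basisVec, Fin.reduceFinMk, Matrix.cons_val, hc]
    fin_cases j <;> simp [valueMatrix]
  · simp only [basisVec, Fin.reduceFinMk, Matrix.cons_val, map_pow, ha]
    fin_cases j <;> simp [valueMatrix] <;> norm_num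
  · simp only [basisVec, Fin.reduceFinMk, Matrix.cons_val, map_pow, ha]
    fin_cases j <;> simp [valueMatrix] <;> norm_num

theorem det_conjMatrix_ne_zero (h2 : (2 : K) ≠ 0) (h3 : (3 : K) ≠ 0) :
    (conjMatrix (K := K)).det ≠ 0 := by
  intro h
  have h1 := (evalPoint (K := K)).map_det conjMatrix
  rw [h, map_zero, evalPoint_conjMatrix] at h1
  have h4 := congrArg (fun M : Matrix (Fin 6) (Fin 6) ℤ ↦ M.map (Int.castRingHom K))
    valueMatrix_mul
  simp only [Matrix.map_mul] at h4
  have h5 := congrArg Matrix.det h4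
  rw [Matrix.det_mul, show (valueMatrix.map (Int.castRingHom K)).det = 0 from h1.symm,
    zero_mul] at h5
  have h72 : ((72 : Matrix (Fin 6) (Fin 6) ℤ).map (Int.castRingHom K)).det = (2 ^ 3 * 3 ^ 2) ^ 6 := by
    rw [show (72 : Matrix (Fin 6) (Fin 6) ℤ).map (Int.castRingHom K) = (72 : K) • 1 by
      ext i j
      by_cases hij : i = j <;> simp [hij, Matrix.ofNat_apply]]
    rw [Matrix.det_smul]
    norm_num
  rw [h72] at h5
  exact pow_ne_zero 6 (mul_ne_zero (pow_ne_zero 3 h2) (pow_ne_zero 2 h3)) h5.symm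

/-- The elements `1, a, b, c, a², a³` are linearly independent over the algebra of pure power sums:
its elements are fixed under permutations of the `zᵢ` alone, so a linear relation persists for the
six conjugates, whose determinant is not zero. -/
theorem eq_zero_of_sum_mixedVec (h2 : (2 : K) ≠ 0) (h3 : (3 : K) ≠ 0)
    (p : Fin 6 → MvPolynomial (Fin 6) K)
    (h : ∑ i, aeval (purePowerSum K) (p i) * mixedVec i = 0) (i : Fin 6) : p i = 0 := by
  have hfix : ∀ (j : Fin 6) (q : MvPolynomial (Fin 6) K), permZ j (aeval (purePowerSum K) q) = aeval (purePowerSum K) q := by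
    intro j q
    rw [← AlgHom.comp_apply, comp_aeval]
    congr 2
    funext i
    exact permZ_purePowerSum j i
  have hmul : conjMatrix.mulVec (fun i ↦ aeval (purePowerSum K) (p i)) = 0 := by
    funext j
    have hj := congrArg (permZ j) h
    simp only [map_sum, map_mul, hfix, map_zero] at hj
    simpa [Matrix.mulVec, dotProduct, conjMatrix, mul_comm] using hj
  have h0 := Matrix.eq_zero_of_mulVec_eq_zero (det_conjMatrix_ne_zero h2 h3) hmul
  have hi : aeval (purePowerSum K) (p i) = aeval (purePowerSum K) (0 : MvPolynomial (Fin 6) K) := by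
    rw [map_zero]
    exact congrFun h0 i
  exact algebraicIndependent_purePowerSum h2 h3 hi

end Independence

/-! ### The kernel of `φ` -/

section Kernel

variable {K : Type*} [Field K]

/-- The inclusion of the polynomial algebra in the six `T_w` with `w` a pure power. -/
noncomputable def pureHom : MvPolynomial (Fin 6) K →ₐ[K] FreeAlg K :=
  aeval fun j ↦ T K (pureWord j)

/-- The combination of `1, T_{xy}, T_{x²y}, T_{xy²}, T_{xy}², T_{xy}³` with coefficients `p`. -/
noncomputable def normalForm (p : Fin 6 → MvPolynomial (Fin 6) K) : FreeAlg K :=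
  ∑ i, pureHom (p i) * basisVec (T K .xy) (T K .x2y) (T K .xy2) i

/-- In each algebra in which the six relations hold, every element of the image is a combination of
the twelve elements `m` and `S m`, where `m = 1, T_{xy}, T_{x²y}, T_{xy²}, T_{xy}², T_{xy}³`, over the
pure power sum variables. -/
theorem exists_map_eq_map_normalForm {A : Type*} [CommRing A] [Algebra K A]
    [Algebra (MvPolynomial (Fin 6) K) A] (h2 : (2 : K) ≠ 0) (h3 : (3 : K) ≠ 0)
    (π : FreeAlg K →ₐ[K] A) (hπ : ∀ i, π (rels K i) = 0)
    (hmap : ∀ p, algebraMap (MvPolynomial (Fin 6) K) A p = π (pureHom p)) (f : FreeAlg K) :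
    ∃ p q : Fin 6 → MvPolynomial (Fin 6) K, π f = π (normalForm p + S K * normalForm q) := by
  have hX : ∀ j, π (T K (pureWord j)) =
      algebraMap (MvPolynomial (Fin 6) K) (A) (X j) := fun j ↦ by
    rw [hmap, pureHom, aeval_X]
  have hunit : ∀ r : K, r ≠ 0 → IsUnit (C r : MvPolynomial (Fin 6) K) := fun r hr ↦
    (IsUnit.mk0 r hr).map C
  have u2 : IsUnit (2 : MvPolynomial (Fin 6) K) := by
    rw [← map_ofNat C 2]
    exact hunit 2 h2
  have u3 : IsUnit (3 : MvPolynomial (Fin 6) K) := by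
    rw [← map_ofNat C 3]
    exact hunit 3 h3
  set N := Submodule.span (MvPolynomial (Fin 6) K)
    (Set.range (basisVec (π (T K .xy)) (π (T K .x2y)) (π (T K .xy2)))) with hN
  have hmul := fun n hn ↦ mul_mem_span_basisVec u2 u3 π hπ (hX 0) (hX 1) (hX 2) (hX 3) (hX 4)
    (hX 5) rfl rfl rfl (n := n) hn
  have hpure : ∀ j, ∀ n ∈ N, π (T K (pureWord j)) * n ∈ N := by
    intro j n hn
    rw [hX, ← Algebra.smul_def]
    exact N.smul_mem _ hn
  have hT : ∀ w, ∀ n ∈ N, π (T K w) * n ∈ N := by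
    intro w n hn
    cases w
    exacts [hpure 0 n hn, hpure 1 n hn, hpure 2 n hn, hpure 3 n hn, hpure 4 n hn, hpure 5 n hn,
      (hmul n hn).1, (hmul n hn).2.1, (hmul n hn).2.2]
  -- the first relation expresses `S²` through pure power sums
  have hS : ∀ n ∈ N, π (S K) * (π (S K) * n) ∈ N := by
    intro n hn
    have e : π (S K) * (π (S K) * n) =
        (C (1 / 3) * X 5 - C (1 / 2) * X 4 * X 3 + C (1 / 6) * X 3 ^ 3 :
          MvPolynomial (Fin 6) K) • n := by
      have h0 := hπ 0
      simp only [rels, Matrix.cons_val, newtonRel, map_add, map_sub, map_mul, map_pow] at h0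
      have hC : ∀ r : K, π (pureHom (C r)) = π (C r) := fun r ↦
        congrArg π (pureHom.commutes r)
      have hXj : ∀ j, π (pureHom (X j)) = π (T K (pureWord j)) := fun j ↦ by
        rw [hX j, hmap]
      rw [Algebra.smul_def, hmap]
      simp only [map_add, map_sub, map_mul, map_pow, hC, hXj, pureWord, Matrix.cons_val]
      linear_combination n * h0
    rw [e]
    exact N.smul_mem _ hn
  have hone : (1 : A) ∈ N := Submodule.subset_span ⟨0, rfl⟩
  have hall : ∃ m ∈ N, ∃ n ∈ N, π f = m + π (S K) * n := by
    induction f using MvPolynomial.induction_on with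
    | C r =>
      refine ⟨π (C r), ?_, 0, N.zero_mem, by simp⟩
      have : π (C r) = (C r : MvPolynomial (Fin 6) K) • (1 : A) := by
        rw [Algebra.smul_def, mul_one, hmap]
        exact (congrArg π (pureHom.commutes r)).symm
      rw [this]
      exact N.smul_mem _ hone
    | add f g hf hg =>
      obtain ⟨m, hm, n, hn, e⟩ := hf
      obtain ⟨m', hm', n', hn', e'⟩ := hg
      exact ⟨m + m', N.add_mem hm hm', n + n', N.add_mem hn hn', by rw [map_add, e, e']; ring⟩
    | mul_X f v hf =>
      obtain ⟨m, hm, n, hn, e⟩ := hf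
      obtain w | _ := v
      · exact ⟨π (T K w) * m, hT w m hm, π (T K w) * n, hT w n hn, by
          rw [map_mul, e, ← T]; ring⟩
      · exact ⟨_, hS n hn, m, hm, by rw [map_mul, e, ← S]; ring⟩
  have hnf : ∀ n ∈ N, ∃ p : Fin 6 → MvPolynomial (Fin 6) K, π (normalForm p) = n := by
    intro n hn
    obtain ⟨p, rfl⟩ := (Submodule.mem_span_range_iff_exists_fun _).mp hn
    refine ⟨p, ?_⟩
    rw [normalForm, map_sum]
    refine Finset.sum_congr rfl fun i _ ↦ ?_
    rw [map_mul, Algebra.smul_def, hmap]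
    congr 1
    fin_cases i <;> simp [basisVec]
  obtain ⟨m, hm, n, hn, e⟩ := hall
  obtain ⟨p, rfl⟩ := hnf m hm
  obtain ⟨q, rfl⟩ := hnf n hn
  exact ⟨p, q, by rw [e, map_add, map_mul]⟩

theorem exists_sub_normalForm_mem (h2 : (2 : K) ≠ 0) (h3 : (3 : K) ≠ 0) (f : FreeAlg K) :
    ∃ p q : Fin 6 → MvPolynomial (Fin 6) K,
      f - (normalForm p + S K * normalForm q) ∈ Ideal.span (Set.range (rels K)) := by
  let π := Ideal.Quotient.mkₐ K (Ideal.span (Set.range (rels K)))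
  have hπ : ∀ i, π (rels K i) = 0 := fun i ↦
    Ideal.Quotient.eq_zero_iff_mem.mpr (Ideal.subset_span ⟨i, rfl⟩)
  obtain ⟨p, q, e⟩ := @exists_map_eq_map_normalForm K _ _ _ _ (π.comp pureHom).toRingHom.toAlgebra
    h2 h3 π hπ (fun _ ↦ rfl) f
  exact ⟨p, q, Ideal.Quotient.eq.mp e⟩

/-- The substitution that expresses the `x_{i,j}` through independent `xᵢ` and `zᵢ`. -/
noncomputable def toXZ : PolyRing 4 K →ₐ[K] XZRing K :=
  aeval fun p ↦ C (2⁻¹ : K) *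
    (if p.1 = {0, 1} then X (.inl 0) + X (.inr 0)
    else if p.1 = {2, 3} then X (.inl 0) - X (.inr 0)
    else if p.1 = {0, 2} then X (.inl 1) + X (.inr 1)
    else if p.1 = {1, 3} then X (.inl 1) - X (.inr 1)
    else if p.1 = {0, 3} then X (.inl 2) + X (.inr 2)
    else X (.inl 2) - X (.inr 2))

theorem toXZ_xx_zz (h2 : (2 : K) ≠ 0) (i : Fin 3) :
    toXZ (xx K i) = X (.inl i) ∧ toXZ (zz K i) = X (.inr i) := by
  have hC : C (2⁻¹ : K) * 2 = (1 : XZRing K) := by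
    rw [show (2 : XZRing K) = C 2 from (map_ofNat C 2).symm, ← C_mul, inv_mul_cancel₀ h2, C_1]
  have h01 : toXZ (pv K 0 1 (by decide)) = C (2⁻¹ : K) * (X (.inl 0) + X (.inr 0)) := by
    rw [toXZ, pv, aeval_X, if_pos (by decide)]
  have h23 : toXZ (pv K 2 3 (by decide)) = C (2⁻¹ : K) * (X (.inl 0) - X (.inr 0)) := by
    rw [toXZ, pv, aeval_X, if_neg (by decide), if_pos (by decide)]
  have h02 : toXZ (pv K 0 2 (by decide)) = C (2⁻¹ : K) * (X (.inl 1) + X (.inr 1)) := by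
    rw [toXZ, pv, aeval_X, if_neg (by decide), if_neg (by decide), if_pos (by decide)]
  have h13 : toXZ (pv K 1 3 (by decide)) = C (2⁻¹ : K) * (X (.inl 1) - X (.inr 1)) := by
    rw [toXZ, pv, aeval_X, if_neg (by decide), if_neg (by decide), if_neg (by decide),
      if_pos (by decide)]
  have h03 : toXZ (pv K 0 3 (by decide)) = C (2⁻¹ : K) * (X (.inl 2) + X (.inr 2)) := by
    rw [toXZ, pv, aeval_X, if_neg (by decide), if_neg (by decide), if_neg (by decide),
      if_neg (by decide), if_pos (by decide)]
  have h12 : toXZ (pv K 1 2 (by decide)) = C (2⁻¹ : K) * (X (.inl 2) - X (.inr 2)) := by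
    rw [toXZ, pv, aeval_X, if_neg (by decide), if_neg (by decide), if_neg (by decide),
      if_neg (by decide), if_neg (by decide)]
  have hadd : ∀ a b : XZRing K, C (2⁻¹ : K) * (a + b) + C 2⁻¹ * (a - b) = a := fun a b ↦ by
    linear_combination a * hC
  have hsub : ∀ a b : XZRing K, C (2⁻¹ : K) * (a + b) - C 2⁻¹ * (a - b) = b := fun a b ↦ by
    linear_combination b * hC
  fin_cases i <;>
    simp only [xx, zz, Fin.zero_eta, Fin.mk_one, Fin.reduceFinMk, Matrix.cons_val, map_add,
      map_sub, h01, h02, h03, h12, h13, h23, hadd, hsub, and_self]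

/-- The product of the variables `zᵢ`. -/
noncomputable def zpv : XZRing K := X (.inr 0) * X (.inr 1) * X (.inr 2)

theorem toXZ_phi (h2 : (2 : K) ≠ 0) (f : FreeAlg K) :
    toXZ (phi K f) = powerSumHom (xv K) (yv K) zpv f := by
  rw [← AlgHom.comp_apply]
  congr 1
  apply freeAlg_hom_ext
  · intro w
    rw [phi_eq_powerSumHom, AlgHom.comp_apply, powerSumHom_T, powerSumHom_T]
    cases w <;> simp [powerSum, toXZ_xx_zz h2, xv, yv]
  · rw [phi_eq_powerSumHom, AlgHom.comp_apply, powerSumHom_S, powerSumHom_S]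
    simp [zprod, toXZ_xx_zz h2, zpv]

theorem powerSumHom_normalForm (p : Fin 6 → MvPolynomial (Fin 6) K) :
    powerSumHom (xv K) (yv K) zpv (normalForm p) =
      ∑ i, aeval (purePowerSum K) (p i) * mixedVec i := by
  rw [normalForm, map_sum]
  refine Finset.sum_congr rfl fun i _ ↦ ?_
  rw [map_mul]
  congr 1
  · rw [pureHom, ← AlgHom.comp_apply, comp_aeval]
    congr 2
    funext j
    exact powerSumHom_T _ _ _ _
  · fin_cases i <;> simp [basisVec, mixedVec]

/-- The automorphism `zᵢ ↦ -zᵢ`. -/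
noncomputable def negZ : XZRing K →ₐ[K] XZRing K :=
  aeval (Sum.elim (fun i ↦ X (.inl i)) (fun i ↦ -X (.inr i)))

theorem negZ_powerSum (w : Word) : negZ (powerSum (xv K) (yv K) w) = powerSum (xv K) (yv K) w := by
  cases w <;> simp [negZ, powerSum, xv, yv]

theorem negZ_normalForm (p : Fin 6 → MvPolynomial (Fin 6) K) :
    negZ (powerSumHom (xv K) (yv K) zpv (normalForm p)) =
      powerSumHom (xv K) (yv K) zpv (normalForm p) := by
  rw [powerSumHom_normalForm, map_sum]
  refine Finset.sum_congr rfl fun i _ ↦ ?_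
  rw [map_mul]
  congr 1
  · rw [← AlgHom.comp_apply, comp_aeval]
    congr 2
    funext j
    exact negZ_powerSum _
  · fin_cases i <;> simp [basisVec, mixedVec, negZ_powerSum]

/-- The six relations generate the kernel of `φ`. In the image, the part with the factor
`z₁ z₂ z₃` is separated from the other by the automorphism `zᵢ ↦ -zᵢ`. -/
theorem ker_phi (h2 : (2 : K) ≠ 0) (h3 : (3 : K) ≠ 0) :
    Ideal.span (Set.range (rels K)) = RingHom.ker (phi K) := by
  apply le_antisymm
  · rw [Ideal.span_le]
    rintro _ ⟨i, rfl⟩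
    change phi K (rels K i) = 0
    rw [phi_eq_powerSumHom]
    exact powerSumHom_rels h2 h3 _ _ _ (by rw [zprod]; ring) i
  intro f hf
  have hf0 : phi K f = 0 := hf
  obtain ⟨p, q, hpq⟩ := exists_sub_normalForm_mem h2 h3 f
  set θ := powerSumHom (K := K) (xv K) (yv K) zpv with hθ
  have hle : Ideal.span (Set.range (rels K)) ≤ RingHom.ker θ := by
    rw [Ideal.span_le]
    rintro _ ⟨i, rfl⟩
    exact powerSumHom_rels h2 h3 _ _ _ (by simp only [zpv, yv]; ring) i
  have h0 : θ (f - (normalForm p + S K * normalForm q)) = 0 := hle hpq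
  have hθf : θ f = 0 := by rw [hθ, ← toXZ_phi h2, hf0, map_zero]
  rw [map_sub, hθf, map_add, map_mul, powerSumHom_S, zero_sub, neg_eq_zero] at h0
  have h1 := congrArg negZ h0
  have hz : negZ (zpv : XZRing K) = -zpv := by
    simp only [negZ, zpv, map_mul, aeval_X, Sum.elim_inr]
    ring
  rw [map_add, map_mul, negZ_normalForm, negZ_normalForm, hz, map_zero] at h1
  have two_ne : (2 : XZRing K) ≠ 0 := by
    rw [show (2 : XZRing K) = C 2 from (map_ofNat C 2).symm]
    exact (map_ne_zero_iff _ (C_injective _ _)).mpr h2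
  have z_ne : (zpv : XZRing K) ≠ 0 :=
    mul_ne_zero (mul_ne_zero (X_ne_zero _) (X_ne_zero _)) (X_ne_zero _)
  have hp : θ (normalForm p) = 0 := by
    have : 2 * θ (normalForm p) = 0 := by linear_combination h0 + h1
    exact (mul_eq_zero.mp this).resolve_left two_ne
  have hq : θ (normalForm q) = 0 := by
    rw [hp, zero_add] at h0
    exact (mul_eq_zero.mp h0).resolve_left z_ne
  rw [hθ, powerSumHom_normalForm] at hp hq
  have hp0 : normalForm p = 0 := by
    simp [normalForm, eq_zero_of_sum_mixedVec h2 h3 p hp]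
  have hq0 : normalForm q = 0 := by
    simp [normalForm, eq_zero_of_sum_mixedVec h2 h3 q hq]
  simpa [hp0, hq0] using hpq

end Kernel

theorem natCast_ne_zero_of_ringChar {K : Type*} [Field K] (hK : ringChar K = 0 ∨ 3 < ringChar K)
    {n : ℕ} (hn : 0 < n) (hn3 : n ≤ 3) : (n : K) ≠ 0 := by
  intro h
  have hdvd := (ringChar.spec K n).mp h
  obtain h0 | h4 := hK
  · rw [h0, zero_dvd_iff] at hdvd
    omega
  · have := Nat.le_of_dvd hn hdvd
    omega

end PairInv

theorem theorem5p2 (K : Type*) [Field K] (hK : ringChar K = 0 ∨ 3 < ringChar K) :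
    Algebra.adjoin K
        ({PairInv.br (X 0), PairInv.br (X 0 ^ 2), PairInv.br (X 0 ^ 3),
          PairInv.br (X 1 ^ 2), PairInv.br (X 1 ^ 4), PairInv.br (X 1 ^ 6),
          PairInv.br (X 0 * X 1 ^ 2), PairInv.br (X 0 ^ 2 * X 1 ^ 2),
          PairInv.br (X 0 * X 1 ^ 4), PairInv.zprod K} : Set (PairInv.PolyRing 4 K)) =
      PairInv.invariants 4 K ∧
    (PairInv.phi K).range = PairInv.invariants 4 K ∧
    PairInv.MinimallyGenerates (PairInv.rels K) (RingHom.ker (PairInv.phi K)) := by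
  have h2 : (2 : K) ≠ 0 := by
    exact_mod_cast PairInv.natCast_ne_zero_of_ringChar hK (n := 2) (by norm_num) (by norm_num)
  have h3 : (3 : K) ≠ 0 := by
    exact_mod_cast PairInv.natCast_ne_zero_of_ringChar hK (n := 3) (by norm_num) (by norm_num)
  have hgen := PairInv.adjoin_generators K h2 h3
  exact ⟨hgen, (PairInv.range_phi K).trans hgen, PairInv.ker_phi h2 h3,
    PairInv.rels_not_mem h2 h3⟩
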